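/- All polynomials have complex coefficients. A sequence $(p_n)_{n\ge 0}$ is called a sequence of orthogonal polynomials if $\deg p_n=n$ for all $n$ and there is a linear functional $u$ on polynomials with $u(p_mp_n)=0$ for $m\ne n$ and $u(p_n^2)\ne 0$ for all $n$. For $0<q<1$ let $\mathcal{D}_q$ be the Askey-Wilson divided difference operator, $$(\mathcal{D}_qf)\Big(\tfrac{z+1/z}{2}\Big)=\frac{\breve f(q^{1/2}z)-\breve f(q^{-1/2}z)}{\breve e(q^{1/2}z)-\breve e(q^{-1/2}z)},\qquad \breve f(z)=f\Big(\tfrac{z+1/z}{2}\Big),\quad e(x)=x,$$ and for $a\ne 0$ let $$p_n(x;a,b,c,d\,|\,q)=\frac{(ab,ac,ad;q)_n}{a^n}\;{}_4\phi_3\!\left({q^{-n},\,abcdq^{n-1},\,az,\,a/z\atop ab,\,ac,\,ad};q,q\right),\qquad x=\tfrac{z+1/z}{2},$$ be the Askey-Wilson polynomials (with denominators cleared). Given $q_j\in(0,1)$ and affine maps $\phi_j(x)=A_jx+B_j$ with $A_j\ne0$ ($j\in\mathbb N$): * A linear operator $D$ on polynomials is a limiting case of the Askey-Wilson operator along $(q_j,\phi_j)$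 if $Lf=\lim_{j}A_j\,\big(\mathcal{D}_{q_j}(f\circ\phi_j^{-1})\big)\circ\phi_j$ exists coefficientwise for every polynomial $f$, and $Df=\kappa\,(Lf)\circ\tau$ with a constant $\kappa\neq0$ and an affine map $\tau(x)=\alpha x+\beta$, $\alpha\ne 0$, such that $L(f\circ\tau)=\alpha\,(Lf)\circ\tau$ for all $f$. * Polynomials $y_n$ of exact degree $n$ ($n\ge0$) are multiples of the Askey-Wilson polynomials, or special or limiting cases of them, along $(q_j,\phi_j)$ if there are parameters $a_j\neq0$, $b_j,c_j,d_j\in\mathbb C$, independent of $n$, and constants $\mu_{n,j}\in\mathbb C$ such that $y_n=\lim_j\mu_{n,j}\,p_n(\phi_j(\cdot);a_j,b_j,c_j,d_j\,|\,q_j)$ coefficientwise for every $n$. **Theorem.** Let $(p_n)_{n\ge0}$ be a sequence of orthogonal polynomials and let $k\ge1$. 1. Let $0<q<1$. If $(\mathcal{D}_q^kp_{n+k})_{n\ge0}$ is a sequence of orthogonal polynomials, then for every $m\ge1$ the polynomials $(\mathcal{D}_q^{m-1}p_{n+m-1})_{n\ge0}$ are multiples of the Askey-Wilson polynomials, or special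 or limiting cases of them, along the constant sequences $q_j=q$, $\phi_j(x)=x$. 2. Let $D$ be a limiting case of the Askey-Wilson operator along $(q_j,\phi_j)$. If $(D^kp_{n+k})_{n\ge0}$ is a sequence of orthogonal polynomials, then for every $m\ge1$ the polynomials $(D^{m-1}p_{n+m-1})_{n\ge0}$ are multiples of the Askey-Wilson polynomials, or special or limiting cases of them, along the same $(q_j,\phi_j)$. -/

import Mathlib

open Polynomial Filter Topology

noncomputable section

/-- `(p n)` is a sequence of orthogonal polynomials: `p n` has exact degree `n`, and the sequence
is orthogonal with respect to some linear (moment) functional with `u (p n ^ 2) ≠ 0` for all `n`.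
Orthogonality with respect to a positive measure with infinite support is the special case of
functionals given by integration. -/
def IsOrthogonalSequence (p : ℕ → ℂ[X]) : Prop :=
  (∀ n, (p n).degree = n) ∧
    ∃ u : ℂ[X] →ₗ[ℂ] ℂ, (∀ m n, m ≠ n → u (p m * p n) = 0) ∧ ∀ n, u (p n * p n) ≠ 0

/-- The images of `X ^ n` under the Askey-Wilson divided difference operator (first component) and
under the averaging operator `f ↦ (f̆(r z) + f̆(z / r)) / 2` (second component), where `r = q^(1/2)`
and `α = (r + 1 / r) / 2`. -/
def askeyWilsonMonomial (r : ℂ) : ℕ → ℂ[X] × ℂ[X]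
  | 0 => (0, 1)
  | n + 1 =>
    ((askeyWilsonMonomial r n).2 + C ((r + r⁻¹) / 2) * X * (askeyWilsonMonomial r n).1,
      C (((r + r⁻¹) / 2) ^ 2 - 1) * (X ^ 2 - 1) * (askeyWilsonMonomial r n).1
        + C ((r + r⁻¹) / 2) * X * (askeyWilsonMonomial r n).2)

/-- The Askey-Wilson divided difference operator `𝒟_q` on polynomials, defined on monomials and
extended linearly; `askeyWilsonOp_spec` is its usual defining formula. -/
def askeyWilsonOp (q : ℝ) : ℂ[X] →ₗ[ℂ] ℂ[X] :=
  (Polynomial.basisMonomials ℂ).constr ℂ fun n => (askeyWilsonMonomial ((√q : ℝ) : ℂ) n).1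

/-- The point `(z + 1 / z) / 2`. -/
def joukowski (z : ℂ) : ℂ := (z + z⁻¹) / 2

theorem askeyWilsonMonomial_spec (r z : ℂ) (hr : r ≠ 0) (hz : z ≠ 0) (n : ℕ) :
    (askeyWilsonMonomial r n).1.eval (joukowski z) * (joukowski (r * z) - joukowski (r⁻¹ * z))
        = joukowski (r * z) ^ n - joukowski (r⁻¹ * z) ^ n ∧
      (askeyWilsonMonomial r n).2.eval (joukowski z)
        = (joukowski (r * z) ^ n + joukowski (r⁻¹ * z) ^ n) / 2 := by
  induction n with
  | zero => simp [askeyWilsonMonomial]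
  | succ n ih =>
    obtain ⟨h1, h2⟩ := ih
    have e1 : (r + r⁻¹) / 2 * joukowski z
        = (joukowski (r * z) + joukowski (r⁻¹ * z)) / 2 := by
      simp only [joukowski]; field_simp; ring
    have e2 : (((r + r⁻¹) / 2) ^ 2 - 1) * (joukowski z ^ 2 - 1)
        = ((joukowski (r * z) - joukowski (r⁻¹ * z)) / 2) ^ 2 := by
      simp only [joukowski]; field_simp; ring
    simp only [askeyWilsonMonomial, eval_add, eval_mul, eval_C, eval_X, eval_sub, eval_pow,
      eval_one]
    rw [e1, e2, h2]
    constructor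
    · linear_combination (joukowski (r * z) + joukowski (r⁻¹ * z)) / 2 * h1
    · linear_combination (joukowski (r * z) - joukowski (r⁻¹ * z)) / 4 * h1

/-- The defining formula of the Askey-Wilson operator: with `f̆(z) = f((z + 1 / z) / 2)` and
`e(x) = x`, `(𝒟_q f)(x) = (f̆(q^(1/2) z) - f̆(q^(-1/2) z)) / (ĕ(q^(1/2) z) - ĕ(q^(-1/2) z))` at
`x = (z + 1 / z) / 2`, written without the division. -/
theorem askeyWilsonOp_spec (q : ℝ) (hq : 0 < q) (f : ℂ[X]) (z : ℂ) (hz : z ≠ 0) :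
    (askeyWilsonOp q f).eval (joukowski z)
        * (joukowski (((√q : ℝ) : ℂ) * z) - joukowski (((√q : ℝ) : ℂ)⁻¹ * z))
      = f.eval (joukowski (((√q : ℝ) : ℂ) * z))
        - f.eval (joukowski (((√q : ℝ) : ℂ)⁻¹ * z)) := by
  have hr : ((√q : ℝ) : ℂ) ≠ 0 := by
    exact_mod_cast (Real.sqrt_pos.mpr hq).ne'
  induction f using Polynomial.induction_on' with
  | add f g hf hg => simp only [map_add, eval_add, add_mul, hf, hg]; ring
  | monomial n a =>
    have h : askeyWilsonOp q (monomial n a)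
        = a • (askeyWilsonMonomial ((√q : ℝ) : ℂ) n).1 := by
      have hm : (monomial n a : ℂ[X]) = a • Polynomial.basisMonomials ℂ n := by
        simp [smul_monomial]
      rw [hm, map_smul, askeyWilsonOp, Module.Basis.constr_basis]
    rw [h]
    simp only [eval_smul, smul_eq_mul, eval_monomial]
    linear_combination a * (askeyWilsonMonomial_spec _ z hr hz n).1

/-- The Askey-Wilson operator in the variable `x`, where `t = A x + B` is the variable in which
`𝒟_q` acts; the factor `A` normalizes it so that `X` is mapped to `1`. -/
def rescaledAskeyWilsonOp (q : ℝ) (A B : ℂ) (f : ℂ[X]) : ℂ[X] :=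
  A • (askeyWilsonOp q (f.comp (C A⁻¹ * (X - C B)))).comp (C A * X + C B)

/-- Coefficientwise convergence of a sequence of polynomials. -/
def TendstoPoly (f : ℕ → ℂ[X]) (g : ℂ[X]) : Prop :=
  ∀ i, Tendsto (fun j => (f j).coeff i) atTop (𝓝 (g.coeff i))

/-- `D` is a limiting case of the Askey-Wilson operator along the bases `q j` and the affine changes
of variable `t = A j * x + B j`. The operator `L` is the limit itself: the divided difference
operator of a lattice, such as `d/dx`, the central difference, the symmetric `q`-difference or the
Wilson operator. `D` may differ from `L` by a constant factor and by an affine substitution under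
which `L` is equivariant; this puts `L` into its other customary forms, such as the forward and
backward differences or `f ↦ (f (q x) - f x) / ((q - 1) x)`. -/
def IsLimitingAskeyWilsonOp (q : ℕ → ℝ) (A B : ℕ → ℂ) (D : ℂ[X] →ₗ[ℂ] ℂ[X]) : Prop :=
  ∃ (L : ℂ[X] →ₗ[ℂ] ℂ[X]) (κ a b : ℂ), κ ≠ 0 ∧ a ≠ 0 ∧
    (∀ f, TendstoPoly (fun j => rescaledAskeyWilsonOp (q j) (A j) (B j) f) (L f)) ∧
    (∀ f, L (f.comp (C a * X + C b)) = a • (L f).comp (C a * X + C b)) ∧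
    ∀ f, D f = κ • (L f).comp (C a * X + C b)

/-- The shifted factorial `(a; q)_n`. -/
def qShiftedFactorial (a q : ℂ) (n : ℕ) : ℂ := ∏ j ∈ Finset.range n, (1 - a * q ^ j)

/-- The Askey-Wilson polynomial
`p_n(x; a, b, c, d | q) = (ab, ac, ad; q)_n / a^n *
  ₄φ₃(q^(-n), abcd q^(n-1), a z, a / z; ab, ac, ad; q, q)`, `x = (z + 1 / z) / 2`, `a ≠ 0`.
Here `(ab; q)_n / (ab; q)_k = (ab q^k; q)_(n-k)`, and
`(a z, a / z; q)_k = ∏_{j < k} (1 - 2 a q^j x + a^2 q^(2j))`. -/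
def askeyWilsonPoly (q a b c d : ℂ) (n : ℕ) : ℂ[X] :=
  C ((a ^ n)⁻¹) * ∑ k ∈ Finset.range (n + 1),
    C (qShiftedFactorial (q ^ (-(n : ℤ))) q k
        * qShiftedFactorial (a * b * c * d * q ^ ((n : ℤ) - 1)) q k
        / qShiftedFactorial q q k * q ^ k
        * qShiftedFactorial (a * b * q ^ k) q (n - k)
        * qShiftedFactorial (a * c * q ^ k) q (n - k)
        * qShiftedFactorial (a * d * q ^ k) q (n - k))
      * ∏ j ∈ Finset.range k, (1 - C (2 * a * q ^ j) * X + C (a ^ 2 * q ^ (2 * j)))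

/-- The polynomials `y n`, of exact degree `n`, are multiples of the Askey-Wilson polynomials, or
special or limiting cases of them, along the bases `q j` and the affine changes of variable
`t = A j * x + B j`: there are Askey-Wilson parameters, depending on `j` but not on `n`, such that
each `y n` is the limit of suitable multiples of the `n`-th Askey-Wilson polynomials in `t`.
All sequences may be constant, which gives the multiples of the Askey-Wilson polynomials. -/
def IsLimitingAskeyWilson (q : ℕ → ℝ) (A B : ℕ → ℂ) (y : ℕ → ℂ[X]) : Prop :=
  (∀ n, (y n).degree = n) ∧
    ∃ a b c d : ℕ → ℂ, (∀ j, a j ≠ 0) ∧ ∃ μ : ℕ → ℕ → ℂ,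
      ∀ n, TendstoPoly
        (fun j => μ n j • (askeyWilsonPoly (q j) (a j) (b j) (c j) (d j) n).comp
          (C (A j) * X + C (B j))) (y n)

end

noncomputable section

/-! ### The divided difference operator of a quadratic lattice -/

-- The operator is treated as a divided difference `f ↦ (f(x₊) - f(x₋)) / (x₊ - x₋)`, where `x₊, x₋`
-- are the roots of `y² - 2(αx + β)y + x² - 2βx + γ`, accompanied by the average `𝒮f = (f(x₊) +
-- f(x₋)) / 2`. This three-parameter family contains the rescaled Askey-Wilson operators
-- (`rescaledAskeyWilsonOp_eq`) and is closed under their limits (`exists_lattice_of_tendsto`), so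
-- both halves of the theorem follow from one statement, `isLimitingAskeyWilson_of_tendsto`.
--
-- Let `Qₙ = 𝒟ᵏ pₙ₊ₖ` be orthogonal for `v`. Orthogonality of both `p` and `Q` forces `v` to satisfy
-- Pearson equations, so the `Qₙ` are eigenfunctions of an operator `φ𝒟² + ψ𝒮𝒟` with `deg φ ≤ 2`,
-- `deg ψ ≤ 1` (`exists_latticeOp_eigen`). Such operators lift through `𝒟ᵏ`
-- (`exists_latticeOp_lift_pow`): there is `T` of the same type for which `T pₙ - λₙ pₙ` has degree
-- `< k` when `n ≥ k`. A three-term recursion for `T(X²f)`, `T(Xf)`, `Tf`, combined with the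
-- orthogonality of `p`, shows that this remainder vanishes for every `n`
-- (`OrthogonalWith.eigen_of_recursion`). The eigenvalues are distinct
-- (`latticeEigenvalue_injective`), and the eigenvalue equation descends to `𝒟ᵐ pₙ₊ₘ` for all `m`
-- (`exists_latticeOp_eigen_divDiff_pow`).
--
-- It remains to recognize the eigenfunctions. On a given lattice `T` is determined by `ψ = T X` and
-- the quadratic inhomogeneity `π` of the recursion, five coefficients in all. The Askey-Wilson
-- second order operator obeys the same recursion, and its five coefficients are linear in the
-- homogenized elementary symmetric functions `e₀, …, e₄` of the parameters. Hence every `(π, ψ)` is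
-- a limit of genuine Askey-Wilson data up to a factor (`exists_askeyWilson_near`). Eigenpolynomials
-- of triangular operators with distinct eigenvalues depend continuously on the operator
-- (`tendstoPoly_of_eigen`), which gives the required limit.

/-- Half the sum of the two shifted points `x₊`, `x₋` of a lattice. -/
def latticeMean (α β : ℂ) : ℂ[X] := C α * X + C β

/-- The square of half the difference of the two shifted points of a lattice whose points have the
product `x₊ x₋ = x ^ 2 - 2 β x + γ`. -/
def latticeDisc (α β γ : ℂ) : ℂ[X] := latticeMean α β ^ 2 - (X ^ 2 - C (2 * β) * X + C γ)

/-- `f ↦ f(x₊)`, in the quadratic extension of `ℂ[X]` in which `x₊` lives. -/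
def latticeShift (α β γ : ℂ) : ℂ[X] →ₐ[ℂ] QuadraticAlgebra ℂ[X] (latticeDisc α β γ) 0 :=
  aeval ⟨latticeMean α β, 1⟩

/-- The divided difference `(f(x₊) - f(x₋)) / (x₊ - x₋)`. -/
def divDiff (α β γ : ℂ) : ℂ[X] →ₗ[ℂ] ℂ[X] :=
  ((QuadraticAlgebra.imₗ (latticeDisc α β γ) 0).restrictScalars ℂ).comp
    (latticeShift α β γ).toLinearMap

/-- The average `(f(x₊) + f(x₋)) / 2`. -/
def latticeAvg (α β γ : ℂ) : ℂ[X] →ₗ[ℂ] ℂ[X] :=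
  ((QuadraticAlgebra.reₗ (latticeDisc α β γ) 0).restrictScalars ℂ).comp
    (latticeShift α β γ).toLinearMap

theorem divDiff_apply (α β γ : ℂ) (f : ℂ[X]) : divDiff α β γ f = (latticeShift α β γ f).im := rfl

theorem latticeAvg_apply (α β γ : ℂ) (f : ℂ[X]) :
    latticeAvg α β γ f = (latticeShift α β γ f).re := rfl

theorem divDiff_mul (α β γ : ℂ) (f g : ℂ[X]) :
    divDiff α β γ (f * g)
      = latticeAvg α β γ f * divDiff α β γ g + divDiff α β γ f * latticeAvg α β γ g := by
  simp [divDiff_apply, latticeAvg_apply]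

theorem latticeAvg_mul (α β γ : ℂ) (f g : ℂ[X]) :
    latticeAvg α β γ (f * g) = latticeAvg α β γ f * latticeAvg α β γ g
      + latticeDisc α β γ * (divDiff α β γ f * divDiff α β γ g) := by
  simp [divDiff_apply, latticeAvg_apply, mul_assoc]

@[simp] theorem divDiff_X (α β γ : ℂ) : divDiff α β γ X = 1 := by
  simp [divDiff_apply, latticeShift]

@[simp] theorem latticeAvg_X (α β γ : ℂ) : latticeAvg α β γ X = latticeMean α β := by
  simp [latticeAvg_apply, latticeShift]

@[simp] theorem divDiff_C (α β γ c : ℂ) : divDiff α β γ (C c) = 0 := by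
  simp only [divDiff_apply, ← Polynomial.algebraMap_eq, AlgHom.commutes]; rfl

@[simp] theorem latticeAvg_C (α β γ c : ℂ) : latticeAvg α β γ (C c) = C c := by
  simp only [latticeAvg_apply, ← Polynomial.algebraMap_eq, AlgHom.commutes]; rfl

@[simp] theorem divDiff_one (α β γ : ℂ) : divDiff α β γ 1 = 0 := divDiff_C α β γ 1

@[simp] theorem latticeAvg_one (α β γ : ℂ) : latticeAvg α β γ 1 = 1 := latticeAvg_C α β γ 1

theorem divDiff_C_mul (α β γ c : ℂ) (f : ℂ[X]) :
    divDiff α β γ (C c * f) = C c * divDiff α β γ f := by simp [divDiff_mul]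

theorem latticeAvg_C_mul (α β γ c : ℂ) (f : ℂ[X]) :
    latticeAvg α β γ (C c * f) = C c * latticeAvg α β γ f := by simp [latticeAvg_mul]

theorem divDiff_X_mul (α β γ : ℂ) (f : ℂ[X]) :
    divDiff α β γ (X * f) = latticeMean α β * divDiff α β γ f + latticeAvg α β γ f := by
  simp [divDiff_mul]

theorem latticeAvg_X_mul (α β γ : ℂ) (f : ℂ[X]) :
    latticeAvg α β γ (X * f)
      = latticeMean α β * latticeAvg α β γ f + latticeDisc α β γ * divDiff α β γ f := by
  simp [latticeAvg_mul]

/-- Induction on polynomials by addition of a constant and multiplication by `X`. -/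
theorem polynomial_induction_X_mul {P : ℂ[X] → Prop} (hC : ∀ c, P (C c))
    (hadd : ∀ f g, P f → P g → P (f + g)) (hX : ∀ f, P f → P (X * f)) (f : ℂ[X]) : P f := by
  have hmon : ∀ (n : ℕ) (c : ℂ), P (X ^ n * C c) := by
    intro n
    induction n with
    | zero => intro c; simpa using hC c
    | succ n ih => intro c; rw [pow_succ', mul_assoc]; exact hX _ (ih c)
  induction f using Polynomial.induction_on' with
  | add f g hf hg => exact hadd f g hf hg
  | monomial n a => rw [← C_mul_X_pow_eq_monomial, mul_comm]; exact hmon n a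

/-- The polynomial `U₁` with `𝒟 𝒮 = α 𝒮 𝒟 + U₁ 𝒟²`. -/
def latticeDrift (α β : ℂ) : ℂ[X] := C (α ^ 2 - 1) * X + C (β * (α + 1))

theorem latticeAvg_mean (α β γ : ℂ) :
    latticeAvg α β γ (latticeMean α β) = C α * latticeMean α β + C β := by
  conv_lhs => rw [latticeMean]
  simp [latticeAvg_C_mul]

theorem divDiff_mean (α β γ : ℂ) : divDiff α β γ (latticeMean α β) = C α := by
  simp [latticeMean, divDiff_C_mul]

theorem divDiff_disc (α β γ : ℂ) :
    divDiff α β γ (latticeDisc α β γ) = C (2 * α) * latticeDrift α β := by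
  simp only [latticeDisc, map_sub, map_add, pow_two, divDiff_mul, divDiff_mean, latticeAvg_mean,
    divDiff_X, latticeAvg_X, divDiff_C, latticeAvg_C]
  simp only [latticeMean, latticeDrift, map_mul, map_sub, map_pow, map_add, map_one, map_ofNat]
  ring

theorem latticeAvg_disc (α β γ : ℂ) :
    latticeAvg α β γ (latticeDisc α β γ)
      = C (α ^ 2) * latticeDisc α β γ + latticeDrift α β ^ 2 := by
  conv_lhs => rw [latticeDisc]
  simp only [map_sub, map_add, pow_two, latticeAvg_mul, divDiff_mean, latticeAvg_mean,
    divDiff_X, latticeAvg_X, divDiff_C, latticeAvg_C]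
  simp only [latticeDisc, latticeMean, latticeDrift, map_mul, map_sub, map_pow, map_add, map_one,
    map_ofNat]
  ring

/-- With `latticeAvg_latticeAvg` this brings words in `𝒟` and `𝒮` to a normal form, which is why the
operators `φ𝒟² + ψ𝒮𝒟` are stable under passing `𝒟` through them. -/
theorem divDiff_latticeAvg (α β γ : ℂ) (f : ℂ[X]) :
    divDiff α β γ (latticeAvg α β γ f)
      = C α * latticeAvg α β γ (divDiff α β γ f)
        + latticeDrift α β * divDiff α β γ (divDiff α β γ f) := by
  induction f using polynomial_induction_X_mul with
  | hC c => simp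
  | hadd f g hf hg => simp only [map_add, hf, hg]; ring
  | hX f hf =>
    rw [latticeAvg_X_mul, divDiff_X_mul]
    simp only [map_add, divDiff_mul, latticeAvg_mul,
      latticeAvg_mean, divDiff_mean, latticeAvg_disc, divDiff_disc, hf]
    simp only [map_mul, map_ofNat, map_pow]
    ring

theorem latticeAvg_latticeAvg (α β γ : ℂ) (f : ℂ[X]) :
    latticeAvg α β γ (latticeAvg α β γ f)
      = C α * latticeDisc α β γ * divDiff α β γ (divDiff α β γ f)
        + latticeDrift α β * latticeAvg α β γ (divDiff α β γ f) + f := by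
  induction f using polynomial_induction_X_mul with
  | hC c => simp
  | hadd f g hf hg => simp only [map_add, hf, hg]; ring
  | hX f hf =>
    rw [latticeAvg_X_mul, divDiff_X_mul]
    simp only [map_add, divDiff_mul, latticeAvg_mul,
      latticeAvg_mean, divDiff_mean, latticeAvg_disc, divDiff_disc, divDiff_latticeAvg, hf]
    simp only [latticeDrift, latticeMean, map_mul, map_ofNat, map_pow, map_sub, map_add, map_one]
    ring


/-! ### Degrees -/

-- For `α = cosh θ` these are `sinh(nθ) / sinh θ` and `cosh(nθ)`, that is, the Chebyshev values
-- `Uₙ₋₁(α)` and `Tₙ(α)`.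
mutual
/-- The leading coefficient of the divided difference of `X ^ n`. -/
def diffLead (α : ℂ) : ℕ → ℂ
  | 0 => 0
  | n + 1 => avgLead α n + α * diffLead α n
/-- The leading coefficient of the average of `X ^ n`. -/
def avgLead (α : ℂ) : ℕ → ℂ
  | 0 => 1
  | n + 1 => (α ^ 2 - 1) * diffLead α n + α * avgLead α n
end

theorem natDegree_latticeMean_le (α β : ℂ) : (latticeMean α β).natDegree ≤ 1 :=
  natDegree_linear_le

theorem latticeDisc_eq (α β γ : ℂ) : latticeDisc α β γ
    = C (α ^ 2 - 1) * X ^ 2 + C (2 * α * β + 2 * β) * X + C (β ^ 2 - γ) := by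
  simp only [latticeDisc, latticeMean, map_mul, map_sub, map_pow, map_add, map_one, map_ofNat]
  ring

theorem natDegree_latticeDisc_le (α β γ : ℂ) : (latticeDisc α β γ).natDegree ≤ 2 := by
  rw [latticeDisc_eq]; exact natDegree_quadratic_le

theorem natDegree_latticeDrift_le (α β : ℂ) : (latticeDrift α β).natDegree ≤ 1 :=
  natDegree_linear_le

theorem natDegree_le_of_X_mul {f : ℂ[X]} {n : ℕ} (h : (X * f).natDegree ≤ n + 1) :
    f.natDegree ≤ n := by
  rw [natDegree_le_iff_coeff_eq_zero] at h ⊢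
  intro i hi
  rw [← coeff_X_mul]
  exact h _ (by omega)

/-- The factor `X` in front of the divided difference avoids the index `n - 1`. Both operators are
handled together because their rules for multiplication by `X` are coupled. -/
theorem divDiff_latticeAvg_degree (α β γ : ℂ) (n : ℕ) : ∀ f : ℂ[X], f.natDegree ≤ n →
    ((X * divDiff α β γ f).natDegree ≤ n ∧
      (X * divDiff α β γ f).coeff n = diffLead α n * f.coeff n) ∧
    (latticeAvg α β γ f).natDegree ≤ n ∧
      (latticeAvg α β γ f).coeff n = avgLead α n * f.coeff n := by
  induction n with
  | zero =>
    intro f hf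
    rw [eq_C_of_natDegree_le_zero hf]
    simp [diffLead, avgLead]
  | succ n ih =>
    intro f hf
    have hg : f.divX.natDegree ≤ n := by rw [natDegree_divX_eq_natDegree_tsub_one]; omega
    obtain ⟨⟨h1, h2⟩, h3, h4⟩ := ih _ hg
    have hfe : f = X * f.divX + C (f.coeff 0) := (X_mul_divX_add f).symm
    have hc : f.coeff (n + 1) = f.divX.coeff n := by rw [coeff_divX]
    have he := natDegree_latticeMean_le α β
    have he1 : (latticeMean α β).coeff 1 = α := by simp [latticeMean]
    have hD : X * divDiff α β γ f
        = latticeMean α β * (X * divDiff α β γ f.divX) + X * latticeAvg α β γ f.divX := by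
      conv_lhs => rw [hfe]
      rw [map_add, divDiff_X_mul, divDiff_C]; ring
    have hM : latticeAvg α β γ f = latticeMean α β * latticeAvg α β γ f.divX
        + latticeDisc α β γ * divDiff α β γ f.divX + C (f.coeff 0) := by
      conv_lhs => rw [hfe]
      rw [map_add, latticeAvg_X_mul, latticeAvg_C]
    have hU : X * (latticeDisc α β γ * divDiff α β γ f.divX)
        = latticeDisc α β γ * (X * divDiff α β γ f.divX) := by ring
    have hU0 := natDegree_latticeDisc_le α β γ
    have hU2 : (latticeDisc α β γ).coeff 2 = α ^ 2 - 1 := by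
      rw [latticeDisc_eq, coeff_add, coeff_add, coeff_C_mul, coeff_C_mul, coeff_X_pow, coeff_X,
        coeff_C]
      simp
    have hU3 : (latticeDisc α β γ * divDiff α β γ f.divX).natDegree ≤ n + 1 := by
      apply natDegree_le_of_X_mul
      rw [hU]
      exact (natDegree_mul_le_of_le hU0 h1).trans (by omega)
    have hU4 : (latticeDisc α β γ * divDiff α β γ f.divX).coeff (n + 1)
        = (α ^ 2 - 1) * (diffLead α n * f.divX.coeff n) := by
      rw [← coeff_X_mul, hU, show n + 1 + 1 = 2 + n by ring, coeff_mul_add_eq_of_natDegree_le hU0 h1, hU2,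
        h2]
    refine ⟨⟨?_, ?_⟩, ?_, ?_⟩
    · rw [hD]
      refine natDegree_add_le_of_degree_le ?_ ?_
      · exact (natDegree_mul_le_of_le he h1).trans (by omega)
      · exact (natDegree_mul_le_of_le natDegree_X_le h3).trans (by omega)
    · rw [hD, coeff_add, coeff_X_mul, add_comm n 1, coeff_mul_add_eq_of_natDegree_le he h1, he1, h2, h4,
        add_comm 1 n, hc, diffLead]
      ring
    · rw [hM]
      refine natDegree_add_le_of_degree_le (natDegree_add_le_of_degree_le ?_ hU3) ?_
      · exact (natDegree_mul_le_of_le he h3).trans (by omega)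
      · simp
    · rw [hM, coeff_add, coeff_add, hU4, add_comm n 1, coeff_mul_add_eq_of_natDegree_le he h3, he1, h4,
        add_comm 1 n, hc, coeff_C_succ, avgLead]
      ring

theorem natDegree_divDiff_le (α β γ : ℂ) {f : ℂ[X]} {n : ℕ} (hf : f.natDegree ≤ n + 1) :
    (divDiff α β γ f).natDegree ≤ n :=
  natDegree_le_of_X_mul (divDiff_latticeAvg_degree α β γ _ f hf).1.1

theorem coeff_divDiff (α β γ : ℂ) {f : ℂ[X]} {n : ℕ} (hf : f.natDegree ≤ n + 1) :
    (divDiff α β γ f).coeff n = diffLead α (n + 1) * f.coeff (n + 1) := by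
  rw [← coeff_X_mul]
  exact (divDiff_latticeAvg_degree α β γ _ f hf).1.2

theorem natDegree_latticeAvg_le (α β γ : ℂ) {f : ℂ[X]} {n : ℕ} (hf : f.natDegree ≤ n) :
    (latticeAvg α β γ f).natDegree ≤ n :=
  (divDiff_latticeAvg_degree α β γ _ f hf).2.1

/-- A Leibniz rule for one factor `X`. It expresses `𝒮𝒟ᵏf` through `𝒟ᵏ⁺¹(Xf)` and `𝒟ᵏ⁺¹f`, the two
quantities that the orthogonality of `p` and of its divided differences controls. -/
theorem divDiff_pow_succ_X_mul (α β γ : ℂ) (k : ℕ) : ∃ b, ∀ f : ℂ[X],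
    (divDiff α β γ ^ (k + 1)) (X * f)
      = C (diffLead α (k + 1)) * latticeAvg α β γ ((divDiff α β γ ^ k) f)
        + (C (avgLead α (k + 1)) * X + C b) * (divDiff α β γ ^ (k + 1)) f := by
  induction k with
  | zero =>
    refine ⟨β, fun f => ?_⟩
    simp only [zero_add, pow_one, pow_zero, Module.End.one_apply, divDiff_X_mul, diffLead, avgLead,
      latticeMean]
    simp
    ring
  | succ k ih =>
    obtain ⟨b, hb⟩ := ih
    refine ⟨diffLead α (k + 1) * (β * (α + 1)) + avgLead α (k + 1) * β + b, fun f => ?_⟩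
    have h (g : ℂ[X]) :
        (divDiff α β γ ^ (k + 1 + 1)) g = divDiff α β γ ((divDiff α β γ ^ (k + 1)) g) := by
      rw [pow_succ' (divDiff α β γ) (k + 1), Module.End.mul_apply]
    have h' (g : ℂ[X]) : (divDiff α β γ ^ (k + 1)) g = divDiff α β γ ((divDiff α β γ ^ k) g) := by
      rw [pow_succ', Module.End.mul_apply]
    rw [h (X * f), hb, map_add, add_mul, map_add, mul_assoc (C _) X, divDiff_C_mul, divDiff_C_mul,
      divDiff_C_mul, divDiff_X_mul, divDiff_latticeAvg, ← h', ← h]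
    rw [show diffLead α (k + 1 + 1) = avgLead α (k + 1) + α * diffLead α (k + 1) by rw [diffLead],
      show avgLead α (k + 1 + 1) = (α ^ 2 - 1) * diffLead α (k + 1) + α * avgLead α (k + 1) by
        rw [avgLead]]
    simp only [latticeDrift, latticeMean, map_mul, map_pow, map_sub, map_add, map_one]
    ring

/-! ### Second order operators -/

/-- The operator `φ 𝒟² + ψ 𝒮 𝒟`. -/
def latticeOp (α β γ : ℂ) (φ ψ : ℂ[X]) : ℂ[X] →ₗ[ℂ] ℂ[X] :=
  (LinearMap.mulLeft ℂ φ).comp ((divDiff α β γ).comp (divDiff α β γ))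
    + (LinearMap.mulLeft ℂ ψ).comp ((latticeAvg α β γ).comp (divDiff α β γ))

theorem latticeOp_apply (α β γ : ℂ) (φ ψ f : ℂ[X]) : latticeOp α β γ φ ψ f
    = φ * divDiff α β γ (divDiff α β γ f) + ψ * latticeAvg α β γ (divDiff α β γ f) := rfl

/-- Half the sum of the two points that lie two shifts apart. -/
def latticeMean₂ (α β : ℂ) : ℂ[X] := C (2 * α ^ 2 - 1) * X + C (2 * β * (α + 1))

/-- The product of the two points that lie two shifts apart. -/
def latticeNorm₂ (α β γ : ℂ) : ℂ[X] := latticeMean₂ α β ^ 2 - C (4 * α ^ 2) * latticeDisc α β γ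

/-- The operator at `x` involves `f` only at `x` and at the two points two shifts apart. Multiplying
`f` by the quadratic vanishing at those two points, `X² - 2lX + κ` with `l`, `κ` frozen at `x`,
leaves a multiple of `f(x)`. -/
theorem latticeOp_X_mul_X_mul (α β γ : ℂ) (φ ψ f : ℂ[X]) :
    latticeOp α β γ φ ψ (X * (X * f))
      = 2 * latticeMean₂ α β * latticeOp α β γ φ ψ (X * f)
        - latticeNorm₂ α β γ * latticeOp α β γ φ ψ f
        + (C (2 * α) * φ + (X - latticeMean₂ α β) * ψ) * f := by
  simp only [latticeOp_apply]
  rw [divDiff_X_mul, latticeAvg_X_mul, divDiff_X_mul]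
  simp only [map_add, divDiff_mul, latticeAvg_mul, latticeAvg_mean, divDiff_mean, latticeAvg_disc,
    divDiff_disc, divDiff_latticeAvg, latticeAvg_latticeAvg]
  simp only [latticeNorm₂, latticeMean₂, latticeDrift, latticeMean, map_mul, map_ofNat, map_pow,
    map_sub, map_add, map_one]
  ring

/-- The intertwining relation: a divided difference of an eigenfunction is an eigenfunction of
another operator of the same type when `𝒟ψ` is constant. -/
theorem divDiff_latticeOp (α β γ : ℂ) (φ ψ f : ℂ[X]) :
    divDiff α β γ (latticeOp α β γ φ ψ f)
      = latticeOp α β γ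
          (latticeAvg α β γ φ + C α * latticeDisc α β γ * divDiff α β γ ψ
            + latticeDrift α β * latticeAvg α β γ ψ)
          (divDiff α β γ φ + latticeDrift α β * divDiff α β γ ψ + C α * latticeAvg α β γ ψ)
          (divDiff α β γ f)
        + divDiff α β γ ψ * divDiff α β γ f := by
  simp only [latticeOp_apply, map_add, divDiff_mul, divDiff_latticeAvg, latticeAvg_latticeAvg]
  ring

theorem exists_divDiff_pow_latticeOp (α β γ : ℂ) (m : ℕ) {φ ψ : ℂ[X]} (hφ : φ.natDegree ≤ 2)
    (hψ : ψ.natDegree ≤ 1) : ∃ φ' ψ' : ℂ[X], ∃ c : ℂ, φ'.natDegree ≤ 2 ∧ ψ'.natDegree ≤ 1 ∧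
      ∀ f, (divDiff α β γ ^ m) (latticeOp α β γ φ ψ f)
        = latticeOp α β γ φ' ψ' ((divDiff α β γ ^ m) f) + C c * (divDiff α β γ ^ m) f := by
  induction m with
  | zero => exact ⟨φ, ψ, 0, hφ, hψ, fun f => by simp⟩
  | succ m ih =>
    obtain ⟨φ', ψ', c, hφ', hψ', h⟩ := ih
    have hDφ := natDegree_divDiff_le α β γ hφ'
    have hDψ := natDegree_divDiff_le α β γ (n := 0) hψ'
    have hMφ := natDegree_latticeAvg_le α β γ hφ'
    have hMψ := natDegree_latticeAvg_le α β γ hψ'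
    have hU := natDegree_latticeDisc_le α β γ
    have hU1 := natDegree_latticeDrift_le α β
    refine ⟨latticeAvg α β γ φ' + C α * latticeDisc α β γ * divDiff α β γ ψ'
        + latticeDrift α β * latticeAvg α β γ ψ',
      divDiff α β γ φ' + latticeDrift α β * divDiff α β γ ψ' + C α * latticeAvg α β γ ψ',
      c + (divDiff α β γ ψ').coeff 0, ?_, ?_, fun f => ?_⟩
    rotate_left 2
    · rw [pow_succ', Module.End.mul_apply, Module.End.mul_apply, h, map_add, divDiff_C_mul,
        divDiff_latticeOp, add_assoc]
      congr 1
      nth_rewrite 1 [eq_C_of_natDegree_le_zero hDψ]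
      rw [C_add]; ring
    · refine natDegree_add_le_of_degree_le (natDegree_add_le_of_degree_le hMφ ?_) ?_
      · exact natDegree_mul_le_of_le (natDegree_mul_le_of_le (natDegree_C _).le hU) hDψ
      · exact natDegree_mul_le_of_le hU1 hMψ
    · refine natDegree_add_le_of_degree_le (natDegree_add_le_of_degree_le hDφ ?_) ?_
      · exact natDegree_mul_le_of_le hU1 hDψ
      · exact natDegree_mul_le_of_le (natDegree_C _).le hMψ

theorem divDiff_quadratic (α β γ a b c : ℂ) :
    divDiff α β γ (C a * X ^ 2 + C b * X + C c)
      = C (2 * a * α) * X + C (2 * a * β + b) := by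
  simp only [map_add, divDiff_C, latticeAvg_C, divDiff_X, pow_two, divDiff_mul, latticeAvg_X,
    latticeMean, map_mul, map_ofNat]
  ring

theorem latticeAvg_quadratic (α β γ a b c : ℂ) :
    latticeAvg α β γ (C a * X ^ 2 + C b * X + C c)
      = C a * (C (2 * α ^ 2 - 1) * X ^ 2 + C (4 * α * β + 2 * β) * X + C (2 * β ^ 2 - γ))
        + C b * latticeMean α β + C c := by
  simp only [map_add, latticeAvg_C, divDiff_C, divDiff_X, pow_two, latticeAvg_mul,
    latticeAvg_X, latticeMean, latticeDisc_eq, map_mul, map_ofNat, map_sub, map_one]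
  ring

/-- The passage from `(φ, ψ)` to the coefficients in `divDiff_latticeOp` is linear and block
triangular, with blocks of determinant `1`; hence it is invertible for every `α`. -/
theorem exists_latticeOp_lift (α β γ : ℂ) {φ' ψ' : ℂ[X]} (hφ : φ'.natDegree ≤ 2)
    (hψ : ψ'.natDegree ≤ 1) : ∃ φ ψ : ℂ[X], ∃ c : ℂ, φ.natDegree ≤ 2 ∧ ψ.natDegree ≤ 1 ∧
      ∀ f, divDiff α β γ (latticeOp α β γ φ ψ f)
        = latticeOp α β γ φ' ψ' (divDiff α β γ f) + C c * divDiff α β γ f := by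
  obtain ⟨a₂, a₁, a₀, rfl⟩ : ∃ a₂ a₁ a₀ : ℂ, φ' = C a₂ * X ^ 2 + C a₁ * X + C a₀ :=
    ⟨_, _, _, eq_quadratic_of_degree_le_two (natDegree_le_iff_degree_le.mp hφ)⟩
  obtain ⟨b₁, b₀, rfl⟩ : ∃ b₁ b₀ : ℂ, ψ' = C b₁ * X + C b₀ :=
    exists_eq_X_add_C_of_natDegree_le_one hψ
  -- Back substitution: `f₂`, `g₁` invert the block `((2α² - 1, 2α(α² - 1)), (2α, 2α² - 1))`; `f₁`,
  -- `g₀` invert `((α, α² - 1), (1, α))` with right-hand side `(r, s)`; `f₀` is then forced.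
  obtain ⟨f₂, hf₂⟩ : ∃ x, x = (2 * α ^ 2 - 1) * a₂ - 2 * α * (α ^ 2 - 1) * b₁ := ⟨_, rfl⟩
  obtain ⟨g₁, hg₁⟩ : ∃ x, x = (2 * α ^ 2 - 1) * b₁ - 2 * α * a₂ := ⟨_, rfl⟩
  obtain ⟨s, hs⟩ : ∃ x, x = b₀ - 2 * β * f₂ - g₁ * (β * (α + 1)) - α * β * g₁ := ⟨_, rfl⟩
  obtain ⟨r, hr⟩ : ∃ x, x = a₁ - f₂ * (4 * α * β + 2 * β)
    - g₁ * (α * (2 * α * β + 2 * β) + (α ^ 2 - 1) * β + α * (β * (α + 1))) := ⟨_, rfl⟩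
  obtain ⟨g₀, hg₀⟩ : ∃ x, x = α * s - r := ⟨_, rfl⟩
  obtain ⟨f₁, hf₁⟩ : ∃ x, x = s - α * g₀ := ⟨_, rfl⟩
  obtain ⟨f₀, hf₀⟩ : ∃ x, x = a₀ - f₂ * (2 * β ^ 2 - γ)
    - g₁ * (α * (β ^ 2 - γ) + β * (β * (α + 1))) - β * f₁ - β * (α + 1) * g₀ := ⟨_, rfl⟩
  refine ⟨C f₂ * X ^ 2 + C f₁ * X + C f₀, C g₁ * X + C g₀, g₁, natDegree_quadratic_le,
    natDegree_linear_le, fun f => ?_⟩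
  have hL : divDiff α β γ (C g₁ * X + C g₀) = C g₁ := by simp [divDiff_C_mul]
  have hM : latticeAvg α β γ (C g₁ * X + C g₀) = C g₁ * latticeMean α β + C g₀ := by
    simp [latticeAvg_C_mul]
  have ea₂ : a₂ = (2 * α ^ 2 - 1) * f₂ + 2 * α * (α ^ 2 - 1) * g₁ := by
    rw [hf₂, hg₁]; ring
  have eb₁ : b₁ = 2 * α * f₂ + (2 * α ^ 2 - 1) * g₁ := by rw [hf₂, hg₁]; ring
  have es : s = f₁ + α * g₀ := by rw [hf₁]; ring
  have er : r = α * f₁ + (α ^ 2 - 1) * g₀ := by rw [hf₁, hg₀]; ring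
  have ea₁ : a₁ = α * f₁ + (α ^ 2 - 1) * g₀ + f₂ * (4 * α * β + 2 * β)
    + g₁ * (α * (2 * α * β + 2 * β) + (α ^ 2 - 1) * β + α * (β * (α + 1))) := by
    rw [← er, hr]; ring
  have eb₀ : b₀ = f₁ + α * g₀ + 2 * β * f₂ + g₁ * (β * (α + 1)) + α * β * g₁ := by
    rw [← es, hs]; ring
  have ea₀ : a₀ = f₀ + f₂ * (2 * β ^ 2 - γ)
    + g₁ * (α * (β ^ 2 - γ) + β * (β * (α + 1))) + β * f₁ + β * (α + 1) * g₀ := by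
    rw [hf₀]; ring
  rw [divDiff_latticeOp, hL, hM, divDiff_quadratic, latticeAvg_quadratic, ea₂, eb₁, ea₁, eb₀, ea₀,
    latticeDisc_eq, latticeDrift, latticeMean]
  congr 3
  · simp only [map_mul, map_ofNat, map_pow, map_sub, map_add, map_one]
    ring
  · simp only [map_mul, map_ofNat, map_pow, map_sub, map_add, map_one]
    ring

theorem exists_latticeOp_lift_pow (α β γ : ℂ) (k : ℕ) {φ' ψ' : ℂ[X]} (hφ : φ'.natDegree ≤ 2)
    (hψ : ψ'.natDegree ≤ 1) : ∃ φ ψ : ℂ[X], ∃ c : ℂ, φ.natDegree ≤ 2 ∧ ψ.natDegree ≤ 1 ∧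
      ∀ f, (divDiff α β γ ^ k) (latticeOp α β γ φ ψ f)
        = latticeOp α β γ φ' ψ' ((divDiff α β γ ^ k) f) + C c * (divDiff α β γ ^ k) f := by
  induction k with
  | zero => exact ⟨φ', ψ', 0, hφ, hψ, fun f => by simp⟩
  | succ k ih =>
    obtain ⟨φ₁, ψ₁, c₁, hφ₁, hψ₁, h₁⟩ := ih
    obtain ⟨φ, ψ, c, hφ, hψ, h⟩ := exists_latticeOp_lift α β γ hφ₁ hψ₁
    refine ⟨φ, ψ, c₁ + c, hφ, hψ, fun f => ?_⟩
    rw [pow_succ, Module.End.mul_apply, Module.End.mul_apply, h, map_add, h₁, ← smul_eq_C_mul c,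
      map_smul, C_add, smul_eq_C_mul]
    ring

/-! ### Orthogonal sequences -/

/-- `p` is a sequence of orthogonal polynomials with respect to the functional `u`. -/
structure OrthogonalWith (p : ℕ → ℂ[X]) (u : ℂ[X] →ₗ[ℂ] ℂ) : Prop where
  degree_eq : ∀ n, (p n).degree = n
  orthogonal : ∀ m n, m ≠ n → u (p m * p n) = 0
  norm_ne_zero : ∀ n, u (p n * p n) ≠ 0

namespace OrthogonalWith

variable {p : ℕ → ℂ[X]} {u : ℂ[X] →ₗ[ℂ] ℂ}

theorem natDegree_eq (hp : OrthogonalWith p u) (n : ℕ) : (p n).natDegree = n :=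
  natDegree_eq_of_degree_eq_some (hp.degree_eq n)

/-- An orthogonal sequence as a basis of `ℂ[X]`. -/
def basis (hp : OrthogonalWith p u) : Module.Basis ℕ ℂ ℂ[X] :=
  Polynomial.Sequence.basis ⟨p, hp.degree_eq⟩ fun i =>
    (leadingCoeff_ne_zero.mpr (Polynomial.Sequence.ne_zero ⟨p, hp.degree_eq⟩ i)).isUnit

theorem basis_apply (hp : OrthogonalWith p u) (n : ℕ) : hp.basis n = p n :=
  Polynomial.Sequence.basis_eq_self ..

theorem functional_mul (hp : OrthogonalWith p u) (i : ℕ) (f : ℂ[X]) :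
    u (p i * f) = hp.basis.repr f i * u (p i * p i) := by
  suffices h : u.comp (LinearMap.mulLeft ℂ (p i))
      = (LinearMap.mulRight ℂ (u (p i * p i))).comp (hp.basis.coord i) from
    LinearMap.congr_fun h f
  refine hp.basis.ext fun j => ?_
  rw [LinearMap.comp_apply, LinearMap.comp_apply, LinearMap.mulLeft_apply,
    LinearMap.mulRight_apply, Module.Basis.coord_apply, Module.Basis.repr_self, hp.basis_apply]
  by_cases h : i = j
  · subst h; simp
  · rw [hp.orthogonal i j h, Finsupp.single_eq_of_ne h, zero_mul]

theorem functional_mul_eq_zero (hp : OrthogonalWith p u) {n : ℕ} {f : ℂ[X]}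
    (hf : f.degree < n) : u (p n * f) = 0 := by
  have hf' : f ∈ degreeLT ℂ n := mem_degreeLT.mpr hf
  have hs := Polynomial.Sequence.span_degreeLT ⟨p, hp.degree_eq⟩ (m := n) fun i _ =>
    (leadingCoeff_ne_zero.mpr (Polynomial.Sequence.ne_zero ⟨p, hp.degree_eq⟩ i)).isUnit
  rw [← hs] at hf'
  clear hf
  induction hf' using Submodule.span_induction with
  | mem x hx =>
    obtain ⟨i, hi, rfl⟩ := hx
    exact hp.orthogonal n i (ne_of_gt hi)
  | zero => simp
  | add x y _ _ hx hy => rw [mul_add, map_add, hx, hy, add_zero]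
  | smul a x _ hx => rw [mul_smul_comm, map_smul, hx, smul_zero]

theorem coeff_ne_zero (hp : OrthogonalWith p u) (n : ℕ) : (p n).coeff n ≠ 0 :=
  coeff_ne_zero_of_eq_degree (hp.degree_eq n)

theorem functional_mul_ne_zero (hp : OrthogonalWith p u) {n : ℕ} {f : ℂ[X]}
    (hf : f.degree = n) : u (p n * f) ≠ 0 := by
  set c := f.leadingCoeff / (p n).leadingCoeff with hc
  have hp0 : (p n).leadingCoeff ≠ 0 :=
    leadingCoeff_ne_zero.mpr (Polynomial.Sequence.ne_zero ⟨p, hp.degree_eq⟩ n)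
  have hf0 : f ≠ 0 := by rintro rfl; simp at hf
  have hc0 : c ≠ 0 := div_ne_zero (leadingCoeff_ne_zero.mpr hf0) hp0
  have hlt : (f - C c * p n).degree < n := by
    rw [← hf]
    refine degree_sub_lt_left ?_ hf0 ?_
    · rw [degree_C_mul hc0, hp.degree_eq, hf]
    · rw [leadingCoeff_mul, leadingCoeff_C, hc, div_mul_cancel₀ _ hp0]
  have h := hp.functional_mul_eq_zero hlt
  rw [mul_sub, map_sub, sub_eq_zero, ← smul_eq_C_mul, mul_smul_comm, map_smul] at h
  rw [h]
  exact smul_ne_zero hc0 (hp.norm_ne_zero n)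

theorem eq_zero (hp : OrthogonalWith p u) {f : ℂ[X]} {n : ℕ} (hf : f.degree < n)
    (h : ∀ g : ℂ[X], g.degree < n → u (g * f) = 0) : f = 0 := by
  by_contra hf0
  have hd : f.degree = f.natDegree := degree_eq_natDegree hf0
  exact hp.functional_mul_ne_zero hd (h _ (by rw [hp.degree_eq, ← hd]; exact hf))

/-- The polynomials orthogonal to all polynomials of degree less than `m`. -/
def tail (u : ℂ[X] →ₗ[ℂ] ℂ) (m : ℕ) : Submodule ℂ ℂ[X] where
  carrier := {f | ∀ g : ℂ[X], g.degree < m → u (g * f) = 0}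
  zero_mem' := by simp
  add_mem' := fun {a b} ha hb g hg => by rw [mul_add, map_add, ha g hg, hb g hg, add_zero]
  smul_mem' := fun c a ha g hg => by rw [mul_smul_comm, map_smul, ha g hg, smul_zero]

theorem mem_tail (hp : OrthogonalWith p u) {m n : ℕ} (h : m ≤ n) : p n ∈ tail u m :=
  fun g hg => by
    rw [mul_comm]
    exact hp.functional_mul_eq_zero (hg.trans_le (by exact_mod_cast h))

theorem tail_mono {m n : ℕ} (h : m ≤ n) {f : ℂ[X]} (hf : f ∈ tail u n) : f ∈ tail u m :=
  fun g hg => hf g (hg.trans_le (by exact_mod_cast h))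

theorem mul_mem_tail {m d : ℕ} {f g : ℂ[X]} (hg : g.natDegree ≤ d) (hf : f ∈ tail u (m + d)) :
    g * f ∈ tail u m := fun h hh => by
  rw [← mul_assoc]
  refine hf _ ?_
  by_cases h0 : h = 0
  · simp [h0]
  rw [degree_eq_natDegree h0, Nat.cast_lt] at hh
  refine degree_le_natDegree.trans_lt ?_
  rw [Nat.cast_lt]
  exact (natDegree_mul_le.trans (by omega : _ ≤ h.natDegree + d)).trans_lt (by omega)

/-- The expansion of an element of `tail u N` in the basis `p` starts at index `N`, so linear
statements need checking only on `p n` with `n ≥ N`. -/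
theorem map_mem_of_mem_tail (hp : OrthogonalWith p u) {V : Type*} [AddCommGroup V] [Module ℂ V]
    (F : ℂ[X] →ₗ[ℂ] V) (W : Submodule ℂ V) {N : ℕ} (hF : ∀ n, N ≤ n → F (p n) ∈ W) {f : ℂ[X]}
    (hf : f ∈ tail u N) : F f ∈ W := by
  rw [← hp.basis.linearCombination_repr f, Finsupp.linearCombination_apply, Finsupp.sum, map_sum]
  refine W.sum_mem fun i _ => ?_
  rw [map_smul, hp.basis_apply]
  by_cases hi : N ≤ i
  · exact W.smul_mem _ (hF i hi)
  · have h0 : u (p i * f) = 0 := hf _ (by rw [hp.degree_eq]; exact_mod_cast not_le.mp hi)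
    rw [hp.functional_mul, mul_eq_zero, or_iff_left (hp.norm_ne_zero i)] at h0
    rw [h0, zero_smul]
    exact W.zero_mem

/-- The operator with eigenvectors `p n` and eigenvalues `ev n`. -/
def diagonal (hp : OrthogonalWith p u) (ev : ℕ → ℂ) : ℂ[X] →ₗ[ℂ] ℂ[X] :=
  hp.basis.constr ℂ fun n => ev n • p n

theorem diagonal_apply (hp : OrthogonalWith p u) (ev : ℕ → ℂ) (n : ℕ) :
    hp.diagonal ev (p n) = ev n • p n := by
  conv_lhs => rw [← hp.basis_apply n]
  rw [diagonal, Module.Basis.constr_basis]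

theorem diagonal_mem_tail (hp : OrthogonalWith p u) (ev : ℕ → ℂ) {m : ℕ} {f : ℂ[X]}
    (hf : f ∈ tail u m) : hp.diagonal ev f ∈ tail u m := by
  refine hp.map_mem_of_mem_tail _ _ (N := m) (fun n hn => ?_) hf
  rw [diagonal_apply]
  exact Submodule.smul_mem _ _ (hp.mem_tail hn)

/-- An operator with the orthogonal eigenvectors `p n` is symmetric. -/
theorem symmetric_of_eigen (hp : OrthogonalWith p u) {T : ℂ[X] →ₗ[ℂ] ℂ[X]} {ev : ℕ → ℂ}
    (hT : ∀ n, T (p n) = C (ev n) * p n) (f g : ℂ[X]) : u (g * T f) = u (f * T g) := by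
  suffices h : ∀ j, ∀ g, u (g * T (p j)) = u (p j * T g) by
    have : (u.comp (LinearMap.mulLeft ℂ g)).comp T = u.comp (LinearMap.mulRight ℂ (T g)) :=
      hp.basis.ext fun j => by
        rw [hp.basis_apply]; exact h j g
    exact LinearMap.congr_fun this f
  intro j g
  have : u.comp (LinearMap.mulRight ℂ (T (p j))) = (u.comp (LinearMap.mulLeft ℂ (p j))).comp T :=
    hp.basis.ext fun i => by
      rw [hp.basis_apply]
      change u (p i * T (p j)) = u (p j * T (p i))
      rw [hT, hT, ← smul_eq_C_mul, ← smul_eq_C_mul, mul_smul_comm, mul_smul_comm, map_smul,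
        map_smul]
      by_cases hij : i = j
      · rw [hij]
      · rw [hp.orthogonal i j hij, hp.orthogonal j i (Ne.symm hij), smul_zero, smul_zero]
  exact LinearMap.congr_fun this g

/-- A symmetric operator that does not raise degrees is diagonal on an orthogonal sequence. -/
theorem eigen_of_symmetric (hp : OrthogonalWith p u) {T : ℂ[X] →ₗ[ℂ] ℂ[X]}
    (hdeg : ∀ n f, natDegree f ≤ n → (T f).natDegree ≤ n)
    (hsymm : ∀ f g, u (g * T f) = u (f * T g)) (n : ℕ) : ∃ ev : ℂ, T (p n) = C ev * p n := by
  refine ⟨(T (p n)).coeff n / (p n).coeff n, sub_eq_zero.mp ?_⟩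
  have hd := hp.natDegree_eq n
  have hp0 := hp.coeff_ne_zero n
  have hT := hdeg n _ hd.le
  refine hp.eq_zero (n := n) ?_ fun g hg => ?_
  · rw [degree_lt_iff_coeff_zero]
    intro m hm
    rw [coeff_sub, coeff_C_mul]
    rcases hm.eq_or_lt with rfl | hm
    · rw [div_mul_cancel₀ _ hp0, sub_self]
    · rw [coeff_eq_zero_of_natDegree_lt (hT.trans_lt hm),
        coeff_eq_zero_of_natDegree_lt (hd.trans_lt hm), mul_zero, sub_zero]
  · have hTg : (T g).degree < n := by
      by_cases h0 : g = 0
      · rw [h0, map_zero, degree_zero]; exact WithBot.bot_lt_coe _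
      rw [degree_eq_natDegree h0, Nat.cast_lt] at hg
      exact degree_le_natDegree.trans_lt (by exact_mod_cast (hdeg _ g le_rfl).trans_lt hg)
    rw [mul_sub, map_sub, hsymm, hp.functional_mul_eq_zero hTg, ← smul_eq_C_mul, mul_smul_comm,
      map_smul, mul_comm g, hp.functional_mul_eq_zero hg, smul_zero, sub_zero]

-- From approximate to exact eigenfunctions by means of a three-term recursion

section Recursion

variable {T : ℂ[X] →ₗ[ℂ] ℂ[X]} {l κ π : ℂ[X]} {ev : ℕ → ℂ}

/-- In the recursion expression for `T - diagonal`, the terms in `T` collapse to `π p`. The diagonal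
part preserves every tail, and each multiplication by a polynomial lowers the tail index by at most
its degree bound. -/
theorem recursion_remainder_mem_tail (hp : OrthogonalWith p u)
    (hl : l.natDegree ≤ 1) (hκ : κ.natDegree ≤ 2) (hπ : π.natDegree ≤ 2)
    (hT : ∀ f, T (X * (X * f)) = 2 * l * T (X * f) - κ * T f + π * f) (n : ℕ) :
    (T - hp.diagonal ev) (X * (X * p (n + 2))) - 2 * l * (T - hp.diagonal ev) (X * p (n + 2))
      + κ * (T - hp.diagonal ev) (p (n + 2)) ∈ tail u n := by
  have h0 : p (n + 2) ∈ tail u (n + 2) := hp.mem_tail le_rfl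
  have h1 : X * p (n + 2) ∈ tail u (n + 1) := mul_mem_tail natDegree_X_le h0
  have h2 : X * (X * p (n + 2)) ∈ tail u n := mul_mem_tail natDegree_X_le h1
  have e : (T - hp.diagonal ev) (X * (X * p (n + 2)))
      - 2 * l * (T - hp.diagonal ev) (X * p (n + 2)) + κ * (T - hp.diagonal ev) (p (n + 2))
      = π * p (n + 2) - hp.diagonal ev (X * (X * p (n + 2)))
        + 2 * l * hp.diagonal ev (X * p (n + 2)) - κ * hp.diagonal ev (p (n + 2)) := by
    simp only [LinearMap.sub_apply, hT]; ring
  have h2l : (2 * l).natDegree ≤ 1 :=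
    (natDegree_mul_le_of_le (natDegree_ofNat 2).le hl).trans (by omega)
  rw [e]
  exact Submodule.sub_mem _ (Submodule.add_mem _ (Submodule.sub_mem _ (mul_mem_tail hπ h0)
    (hp.diagonal_mem_tail ev h2)) (mul_mem_tail h2l (hp.diagonal_mem_tail ev h1)))
    (mul_mem_tail hκ (hp.diagonal_mem_tail ev h0))

/-- The recursion expression for the remainder has bounded degree yet is orthogonal to all
polynomials of degree below `n`, so it is zero for large `n`. Its top coefficient then lowers the
bound `d` by one. -/
theorem eventually_eigen_of_recursion (hp : OrthogonalWith p u)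
    (hl : l.natDegree ≤ 1) (hκ : κ.natDegree ≤ 2) (hκ2 : κ.coeff 2 = 1) (hπ : π.natDegree ≤ 2)
    (hT : ∀ f, T (X * (X * f)) = 2 * l * T (X * f) - κ * T f + π * f) (d : ℕ)
    (h : ∃ N, ∀ n, N ≤ n → (T - hp.diagonal ev) (p n) ∈ degreeLT ℂ d) :
    ∃ N, ∀ n, N ≤ n → (T - hp.diagonal ev) (p n) = 0 := by
  induction d with
  | zero =>
    obtain ⟨N, hN⟩ := h
    refine ⟨N, fun n hn => ?_⟩
    simpa [mem_degreeLT, Nat.WithBot.lt_zero_iff] using hN n hn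
  | succ d ih =>
    obtain ⟨N, hN⟩ := h
    refine ih ⟨N + d + 5, fun n hn => ?_⟩
    obtain ⟨n, rfl⟩ : ∃ n', n = n' + 2 := ⟨n - 2, by omega⟩
    set R := T - hp.diagonal ev
    have hR : ∀ f ∈ tail u N, (R f).natDegree ≤ d := fun f hf => by
      have := hp.map_mem_of_mem_tail R _ hN hf
      rw [degreeLT_succ_eq_degreeLE, mem_degreeLE] at this
      exact natDegree_le_iff_degree_le.mpr this
    have h0 : p (n + 2) ∈ tail u (n + 2) := hp.mem_tail le_rfl
    have h1 : X * p (n + 2) ∈ tail u (n + 1) := mul_mem_tail natDegree_X_le h0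
    have h2 : X * (X * p (n + 2)) ∈ tail u n := mul_mem_tail natDegree_X_le h1
    have r0 := hR _ (tail_mono (by omega) h0)
    have r1 := hR _ (tail_mono (by omega) h1)
    have r2 := hR _ (tail_mono (by omega) h2)
    have h2l : (2 * l).natDegree ≤ 1 :=
      (natDegree_mul_le_of_le (natDegree_ofNat 2).le hl).trans (by omega)
    have hl1 : (2 * l * R (X * p (n + 2))).natDegree ≤ d + 1 :=
      (natDegree_mul_le_of_le h2l r1).trans (by omega)
    have hκ1 : (κ * R (p (n + 2))).natDegree ≤ d + 2 :=
      (natDegree_mul_le_of_le hκ r0).trans (by omega)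
    have hE : R (X * (X * p (n + 2))) - 2 * l * R (X * p (n + 2)) + κ * R (p (n + 2)) = 0 := by
      refine hp.eq_zero (n := n) ?_ (hp.recursion_remainder_mem_tail hl hκ hπ hT n)
      refine degree_le_natDegree.trans_lt ?_
      rw [Nat.cast_lt]
      refine lt_of_le_of_lt (b := d + 2) ?_ (by omega)
      have hs := natDegree_sub_le_of_le r2 hl1
      exact natDegree_add_le_of_degree_le (hs.trans (by simp)) hκ1
    -- Only `κ R(p (n + 2))` reaches degree `d + 2`, and `κ` has leading coefficient `1`, so the
    -- coefficient of `X ^ d` in `R(p (n + 2))` vanishes.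
    have hc := congrArg (fun f => f.coeff (2 + d)) hE
    simp only [coeff_add, coeff_sub, coeff_zero] at hc
    rw [coeff_mul_add_eq_of_natDegree_le hκ r0, hκ2, coeff_eq_zero_of_natDegree_lt (by omega),
      coeff_eq_zero_of_natDegree_lt (by omega)] at hc
    rw [mem_degreeLT, degree_lt_iff_coeff_zero]
    intro m hm
    rcases hm.eq_or_lt with rfl | hm
    · simpa using hc
    · exact coeff_eq_zero_of_natDegree_lt (by omega)

/-- Once the remainder vanishes for all large indices, descent reaches the small ones: `X² p (m +
2)` has a nonzero component along `p m`, and the recursion places the remainder of `p m` in `tail u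
m`, although its degree is below `m`. -/
theorem eigen_of_recursion (hp : OrthogonalWith p u)
    (hl : l.natDegree ≤ 1) (hκ : κ.natDegree ≤ 2) (hκ2 : κ.coeff 2 = 1) (hπ : π.natDegree ≤ 2)
    (hT : ∀ f, T (X * (X * f)) = 2 * l * T (X * f) - κ * T f + π * f)
    (hdeg : ∀ n, (T (p n) - ev n • p n).degree < n) (d : ℕ)
    (h : ∀ n, d ≤ n → (T (p n) - ev n • p n).degree < d) (n : ℕ) : T (p n) = ev n • p n := by
  have hR (n : ℕ) : (T - hp.diagonal ev) (p n) = T (p n) - ev n • p n := by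
    rw [LinearMap.sub_apply, hp.diagonal_apply]
  obtain ⟨N, hN⟩ := hp.eventually_eigen_of_recursion (ev := ev) hl hκ hκ2 hπ hT d
    ⟨d, fun n hn => by rw [hR, mem_degreeLT]; exact h n hn⟩
  suffices key : ∀ N, (∀ n, N ≤ n → (T - hp.diagonal ev) (p n) = 0) →
      ∀ n, (T - hp.diagonal ev) (p n) = 0 by
    have := key N hN n
    rwa [hR, sub_eq_zero] at this
  clear hN N n
  intro N
  induction N with
  | zero => exact fun h n => h n (Nat.zero_le n)
  | succ m ih =>
    intro hm
    refine ih fun n hn => ?_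
    rcases hn.eq_or_lt with rfl | hn
    swap
    · exact hm n hn
    have hz : ∀ f ∈ tail u (m + 1), (T - hp.diagonal ev) f = 0 := fun f hf =>
      (Submodule.mem_bot ℂ).mp
        (hp.map_mem_of_mem_tail _ ⊥ (fun n hn => (Submodule.mem_bot ℂ).mpr (hm n hn)) hf)
    have h0 : p (m + 2) ∈ tail u (m + 2) := hp.mem_tail le_rfl
    have h1 : X * p (m + 2) ∈ tail u (m + 1) := mul_mem_tail natDegree_X_le h0
    have h2 : X * (X * p (m + 2)) ∈ tail u m := mul_mem_tail natDegree_X_le h1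
    have hE := hp.recursion_remainder_mem_tail (ev := ev) hl hκ hπ hT m
    rw [hz _ h1, hz _ (tail_mono (by omega) h0), mul_zero, mul_zero, sub_zero, add_zero] at hE
    -- The coefficient of `p m` in `X² p (m + 2)`; it is nonzero because `X² p m` has exact degree
    -- `m + 2`.
    set t := u (p m * (X * (X * p (m + 2)))) / u (p m * p m) with ht
    have ht0 : t ≠ 0 := by
      refine div_ne_zero ?_ (hp.norm_ne_zero m)
      rw [show p m * (X * (X * p (m + 2))) = p (m + 2) * (p m * X ^ 2) by ring]
      refine hp.functional_mul_ne_zero ?_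
      rw [degree_mul, degree_X_pow, hp.degree_eq]; norm_cast
    have hsub : X * (X * p (m + 2)) - t • p m ∈ tail u (m + 1) := by
      intro g hg
      have hpm := hp.coeff_ne_zero m
      set s := g.coeff m / (p m).coeff m
      have hg' : (g - s • p m).degree < m := by
        rw [degree_lt_iff_coeff_zero]
        intro i hi
        rw [coeff_sub, coeff_smul, smul_eq_mul]
        rcases hi.eq_or_lt with rfl | hi
        · rw [div_mul_cancel₀ _ hpm, sub_self]
        · rw [coeff_eq_zero_of_natDegree_lt ((hp.natDegree_eq m).trans_lt hi),
            coeff_eq_zero_of_degree_lt (hg.trans_le (by exact_mod_cast hi)), mul_zero, sub_zero]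
      have e1 : u ((g - s • p m) * (X * (X * p (m + 2)) - t • p m)) = 0 :=
        (Submodule.sub_mem _ h2 (Submodule.smul_mem _ t (hp.mem_tail le_rfl))) _ hg'
      have e2 : u (p m * (X * (X * p (m + 2)) - t • p m)) = 0 := by
        rw [mul_sub, map_sub, mul_smul_comm, map_smul, smul_eq_mul, ht,
          div_mul_cancel₀ _ (hp.norm_ne_zero m), sub_self]
      rw [sub_mul, map_sub, smul_mul_assoc, map_smul, e2, smul_zero, sub_zero] at e1
      exact e1
    have e3 := hz _ hsub
    rw [map_sub, map_smul, sub_eq_zero] at e3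
    rw [e3, Submodule.smul_mem_iff _ ht0] at hE
    exact hp.eq_zero (by rw [hR]; exact hdeg m) hE

end Recursion

end OrthogonalWith

-- Hyperbolic addition formulas and eigenvalue differences

section LeadingCoefficients

theorem avgLead_sq (α : ℂ) (n : ℕ) :
    avgLead α n ^ 2 = 1 + (α ^ 2 - 1) * diffLead α n ^ 2 := by
  induction n with
  | zero => simp [avgLead, diffLead]
  | succ n ih => rw [avgLead, diffLead]; linear_combination ih

theorem lead_add (α : ℂ) (m n : ℕ) :
    diffLead α (m + n) = diffLead α m * avgLead α n + avgLead α m * diffLead α n ∧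
    avgLead α (m + n)
      = avgLead α m * avgLead α n + (α ^ 2 - 1) * (diffLead α m * diffLead α n) := by
  induction n with
  | zero => simp [avgLead, diffLead]
  | succ n ih =>
    obtain ⟨h1, h2⟩ := ih
    rw [← add_assoc]
    simp only [avgLead, diffLead, h1, h2]
    constructor <;> ring

/-- The diagonal entries of the operator `φ 𝒟² + ψ 𝒮 𝒟`, where `a` and `b` are the coefficients of
`X ^ 2` in `φ` and of `X` in `ψ`. -/
def latticeEigenvalue (α a b : ℂ) (n : ℕ) : ℂ :=
  diffLead α n * (a * (α * diffLead α n - avgLead α n)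
    + b * (α * avgLead α n - (α ^ 2 - 1) * diffLead α n))

@[simp] theorem latticeEigenvalue_zero (α a b : ℂ) : latticeEigenvalue α a b 0 = 0 := by
  simp [latticeEigenvalue, diffLead]

theorem latticeEigenvalue_succ (α a b : ℂ) (n : ℕ) : latticeEigenvalue α a b (n + 1)
    = diffLead α (n + 1) * (a * diffLead α n + b * avgLead α n) := by
  simp only [latticeEigenvalue, avgLead, diffLead]
  ring

/-- A sum-to-product formula: the eigenvalue is `diffLead n` times a combination of `diffLead` and
`avgLead` at `n - 1`, so differences factor. The index `2m + i` is one less than the sum of the two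
compared indices. -/
theorem latticeEigenvalue_sub (α a b : ℂ) (m i : ℕ) :
    latticeEigenvalue α a b (m + (i + 1)) - latticeEigenvalue α a b m
      = diffLead α (i + 1) * (a * diffLead α (2 * m + i) + b * avgLead α (2 * m + i)) := by
  have h1 : diffLead α (2 * m + i)
      = α * diffLead α (m + (m + (i + 1))) - avgLead α (m + (m + (i + 1))) := by
    rw [show m + (m + (i + 1)) = 2 * m + i + 1 by ring, avgLead, diffLead]; ring
  have h2 : avgLead α (2 * m + i) = α * avgLead α (m + (m + (i + 1)))
      - (α ^ 2 - 1) * diffLead α (m + (m + (i + 1))) := by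
    rw [show m + (m + (i + 1)) = 2 * m + i + 1 by ring, avgLead, diffLead]; ring
  rw [h1, h2]
  generalize i + 1 = j
  have hj := avgLead_sq α j
  simp only [latticeEigenvalue, (lead_add α m (m + j)).1, (lead_add α m (m + j)).2,
    (lead_add α m j).1, (lead_add α m j).2]
  linear_combination (a * (α * diffLead α m ^ 2 - diffLead α m * avgLead α m)
    + b * (α * diffLead α m * avgLead α m - (α ^ 2 - 1) * diffLead α m ^ 2)) * hj

end LeadingCoefficients

-- Degree bounds and diagonal entries of the second order operators

theorem natDegree_latticeMean₂_le (α β : ℂ) : (latticeMean₂ α β).natDegree ≤ 1 :=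
  natDegree_linear_le

theorem natDegree_latticeNorm₂_le (α β γ : ℂ) : (latticeNorm₂ α β γ).natDegree ≤ 2 :=
  (natDegree_sub_le_of_le (natDegree_pow_le_of_le 2 (natDegree_latticeMean₂_le α β))
    (natDegree_mul_le_of_le (natDegree_C _).le (natDegree_latticeDisc_le α β γ))).trans (by simp)

theorem coeff_latticeNorm₂ (α β γ : ℂ) : (latticeNorm₂ α β γ).coeff 2 = 1 := by
  have : latticeNorm₂ α β γ = C 1 * X ^ 2
      + C ((2 * α ^ 2 - 1) * (2 * β * (α + 1)) * 2 - 4 * α ^ 2 * (2 * α * β + 2 * β)) * X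
      + C ((2 * β * (α + 1)) ^ 2 - 4 * α ^ 2 * (β ^ 2 - γ)) := by
    simp only [latticeNorm₂, latticeMean₂, latticeDisc_eq, map_mul, map_ofNat, map_pow,
      map_sub, map_add, map_one]
    ring
  rw [this, coeff_add, coeff_add, coeff_C_mul, coeff_C_mul, coeff_X_pow, coeff_X, coeff_C]
  simp

theorem natDegree_latticeOp_inhomogeneity_le (α β : ℂ) {φ ψ : ℂ[X]} (hφ : φ.natDegree ≤ 2)
    (hψ : ψ.natDegree ≤ 1) :
    (C (2 * α) * φ + (X - latticeMean₂ α β) * ψ).natDegree ≤ 2 := by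
  refine natDegree_add_le_of_degree_le ((natDegree_C_mul_le _ _).trans hφ) ?_
  exact natDegree_mul_le_of_le (m := 1) ((natDegree_sub_le_of_le natDegree_X_le
    (natDegree_latticeMean₂_le α β)).trans (by simp)) hψ

theorem latticeOp_degree (α β γ : ℂ) {φ ψ : ℂ[X]} (hφ : φ.natDegree ≤ 2) (hψ : ψ.natDegree ≤ 1)
    (n : ℕ) (f : ℂ[X]) (hf : f.natDegree ≤ n) :
    (latticeOp α β γ φ ψ f).natDegree ≤ n ∧ (latticeOp α β γ φ ψ f).coeff n
      = latticeEigenvalue α (φ.coeff 2) (ψ.coeff 1) n * f.coeff n := by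
  cases n with
  | zero => rw [eq_C_of_natDegree_le_zero hf]; simp [latticeOp_apply]
  | succ n =>
    have hg := natDegree_divDiff_le α β γ hf
    have hgc := coeff_divDiff α β γ hf
    obtain ⟨⟨h1, h2⟩, h3, h4⟩ := divDiff_latticeAvg_degree α β γ n _ hg
    have e : X * (φ * divDiff α β γ (divDiff α β γ f))
        = φ * (X * divDiff α β γ (divDiff α β γ f)) := by ring
    have n1 : (φ * divDiff α β γ (divDiff α β γ f)).natDegree ≤ n + 1 := by
      apply natDegree_le_of_X_mul
      rw [e]
      exact (natDegree_mul_le_of_le hφ h1).trans (by omega)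
    have n2 : (ψ * latticeAvg α β γ (divDiff α β γ f)).natDegree ≤ n + 1 :=
      (natDegree_mul_le_of_le hψ h3).trans (by omega)
    refine ⟨natDegree_add_le_of_degree_le n1 n2, ?_⟩
    rw [latticeOp_apply, coeff_add, ← coeff_X_mul, e, show n + 1 + 1 = 2 + n by ring,
      coeff_mul_add_eq_of_natDegree_le hφ h1, add_comm n 1,
      coeff_mul_add_eq_of_natDegree_le hψ h3, h2, h4, hgc, add_comm 1 n, latticeEigenvalue_succ]
    ring

-- Kernel and range of the divided difference operator

section Surjectivity

variable {α β γ : ℂ} (hα : ∀ n, diffLead α (n + 1) ≠ 0)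
include hα

theorem natDegree_le_of_divDiff {f : ℂ[X]} {n : ℕ} (h : (divDiff α β γ f).degree < n) :
    f.natDegree ≤ n := by
  by_contra hn
  obtain ⟨d, hd⟩ : ∃ d, f.natDegree = d + 1 := ⟨f.natDegree - 1, by omega⟩
  have hc := coeff_divDiff α β γ hd.le
  rw [coeff_eq_zero_of_degree_lt (h.trans_le (by exact_mod_cast (by omega : n ≤ d)))] at hc
  rcases mul_eq_zero.mp hc.symm with h0 | h0
  · exact hα d h0
  · rw [← hd, coeff_natDegree, leadingCoeff_eq_zero] at h0
    simp [h0] at hd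

theorem degree_divDiff {f : ℂ[X]} {n : ℕ} (hf : f.degree = (n + 1 : ℕ)) :
    (divDiff α β γ f).degree = n := by
  have hn := natDegree_eq_of_degree_eq_some hf
  refine degree_eq_of_le_of_coeff_ne_zero
    (natDegree_le_iff_degree_le.mp (natDegree_divDiff_le α β γ hn.le)) ?_
  rw [coeff_divDiff α β γ hn.le]
  exact mul_ne_zero (hα n) (coeff_ne_zero_of_eq_degree hf)

theorem degree_divDiff_pow (m : ℕ) : ∀ {n : ℕ} {f : ℂ[X]}, f.degree = (n + m : ℕ) →
    ((divDiff α β γ ^ m) f).degree = n := by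
  induction m with
  | zero => intro n f hf; simpa using hf
  | succ m ih =>
    intro n f hf
    rw [pow_succ, Module.End.mul_apply]
    exact ih (degree_divDiff hα hf)

theorem degree_lt_of_divDiff_pow_eq_zero (k : ℕ) : ∀ {f : ℂ[X]}, (divDiff α β γ ^ k) f = 0 →
    f.degree < k := by
  induction k with
  | zero => intro f hf; simpa [Nat.WithBot.lt_zero_iff] using hf
  | succ k ih =>
    intro f hf
    rw [pow_succ, Module.End.mul_apply] at hf
    have h := natDegree_le_of_divDiff hα (ih hf)
    exact degree_le_natDegree.trans_lt (by exact_mod_cast Nat.lt_succ_of_le h)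

theorem divDiff_surjective : Function.Surjective (divDiff α β γ) := by
  suffices h : ∀ n : ℕ, ∀ f : ℂ[X], f.degree < n → ∃ g, divDiff α β γ g = f from
    fun f => h (f.natDegree + 1) f
      (degree_le_natDegree.trans_lt (by exact_mod_cast Nat.lt_succ_self _))
  intro n
  induction n with
  | zero => intro f hf; exact ⟨0, by rw [map_zero]; simpa [Nat.WithBot.lt_zero_iff, eq_comm (a := (0 : ℂ[X]))] using hf⟩
  | succ n ih =>
    intro f hf
    have hX : (X ^ (n + 1) : ℂ[X]).natDegree ≤ n + 1 := natDegree_X_pow_le _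
    set c := f.coeff n / diffLead α (n + 1)
    have hlt : (f - c • divDiff α β γ (X ^ (n + 1))).degree < n := by
      rw [degree_lt_iff_coeff_zero]
      intro i hi
      rw [coeff_sub, coeff_smul, smul_eq_mul]
      rcases hi.eq_or_lt with rfl | hi
      · rw [coeff_divDiff α β γ hX, coeff_X_pow_self, mul_one, div_mul_cancel₀ _ (hα n), sub_self]
      · rw [coeff_eq_zero_of_degree_lt (hf.trans_le (by exact_mod_cast hi)),
          coeff_eq_zero_of_natDegree_lt ((natDegree_divDiff_le α β γ hX).trans_lt hi), mul_zero,
          sub_zero]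
    obtain ⟨g, hg⟩ := ih _ hlt
    exact ⟨g + c • X ^ (n + 1), by rw [map_add, map_smul, hg, sub_add_cancel]⟩

/-- The divided difference is onto with only constants in its kernel, so a functional killing
constants factors through it. This produces the second functional of a Pearson pair. -/
theorem exists_functional_divDiff (w : ℂ[X] →ₗ[ℂ] ℂ) (hw : w 1 = 0) :
    ∃ f₀ : ℂ[X] →ₗ[ℂ] ℂ, ∀ g, f₀ (divDiff α β γ g) = w g := by
  obtain ⟨s, hs⟩ := LinearMap.exists_rightInverse_of_surjective (divDiff α β γ)
    (LinearMap.range_eq_top.mpr (divDiff_surjective hα))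
  refine ⟨w.comp s, fun g => ?_⟩
  have h0 : divDiff α β γ (s (divDiff α β γ g) - g) = 0 := by
    rw [map_sub, sub_eq_zero]; exact LinearMap.congr_fun hs _
  have h1 := natDegree_le_of_divDiff hα (β := β) (γ := γ) (n := 0)
    (f := s (divDiff α β γ g) - g) (by rw [h0, degree_zero]; exact WithBot.bot_lt_coe _)
  rw [LinearMap.comp_apply, ← sub_eq_zero, ← map_sub, eq_C_of_natDegree_le_zero h1,
    ← mul_one (C _), ← smul_eq_C_mul, map_smul, hw, smul_zero]

end Surjectivity

/-- A pair of functionals related by Pearson equations makes `φ 𝒟² + ψ 𝒮 𝒟` symmetric. -/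
theorem functional_mul_latticeOp {α β γ : ℂ} {φ ψ : ℂ[X]} {v w : ℂ[X] →ₗ[ℂ] ℂ}
    (hψ : ∀ g, w (divDiff α β γ g) = v (ψ * g))
    (hφ : ∀ g, w (C α * latticeAvg α β γ g + latticeDrift α β * divDiff α β γ g) = - v (φ * g))
    (f g : ℂ[X]) :
    w (divDiff α β γ f * divDiff α β γ g) = v (g * latticeOp α β γ φ ψ f) := by
  -- Summation by parts: by the product rule, `𝒟(g 𝒮𝒟f)` differs from `𝒟f 𝒟g` by `α𝒮 + U₁𝒟` applied
  -- to `g 𝒟²f`.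
  have key : divDiff α β γ f * divDiff α β γ g
      = divDiff α β γ (g * latticeAvg α β γ (divDiff α β γ f))
        - (C α * latticeAvg α β γ (g * divDiff α β γ (divDiff α β γ f))
          + latticeDrift α β * divDiff α β γ (g * divDiff α β γ (divDiff α β γ f))) := by
    simp only [divDiff_mul, latticeAvg_mul, divDiff_latticeAvg, latticeAvg_latticeAvg]
    ring
  rw [key, map_sub, hψ, hφ, sub_neg_eq_add, ← map_add, latticeOp_apply]
  congr 1
  ring

-- Second order equations for orthogonal sequences

section Orthogonal

variable {α β γ : ℂ} {p : ℕ → ℂ[X]} {u v : ℂ[X] →ₗ[ℂ] ℂ}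

theorem exists_latticeOp_eigen (hα : ∀ n, diffLead α (n + 1) ≠ 0) (hp : OrthogonalWith p u)
    (k : ℕ) (hQ : OrthogonalWith (fun n => (divDiff α β γ ^ (k + 1)) (p (n + (k + 1)))) v) :
    ∃ φ ψ : ℂ[X], φ.natDegree ≤ 2 ∧ ψ.natDegree ≤ 1 ∧ ∃ ev : ℕ → ℂ, ev 0 ≠ ev 1 ∧
      ∀ n, latticeOp α β γ φ ψ ((divDiff α β γ ^ (k + 1)) (p (n + (k + 1))))
        = C (ev n) * (divDiff α β γ ^ (k + 1)) (p (n + (k + 1))) := by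
  set Q : ℕ → ℂ[X] := fun n => (divDiff α β γ ^ (k + 1)) (p (n + (k + 1))) with hQdef
  -- The first Pearson equation holds by definition of `w`, with `ψ = Q 1`; it is solvable because
  -- `v (Q 1) = 0`.
  obtain ⟨w, hw⟩ := exists_functional_divDiff (β := β) (γ := γ) hα
    (v.comp (LinearMap.mulLeft ℂ (Q 1)))
    (hQ.functional_mul_eq_zero (by rw [degree_one]; exact_mod_cast zero_lt_one))
  obtain ⟨b, hb⟩ := divDiff_pow_succ_X_mul α β γ k
  let N : ℂ[X] →ₗ[ℂ] ℂ[X] := (LinearMap.mulLeft ℂ (C α)).comp (latticeAvg α β γ)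
    + (LinearMap.mulLeft ℂ (latticeDrift α β)).comp (divDiff α β γ)
  have hN (g : ℂ[X]) :
      N g = C α * latticeAvg α β γ g + latticeDrift α β * divDiff α β γ g := rfl
  -- This bounds the degree in the second Pearson equation: a functional vanishing on `Q 3, Q 4, …`
  -- is `v(φ' ·)` with `deg φ' ≤ 2`.
  have hsmall (n : ℕ) : w (N (Q (n + 3))) = 0 := by
    -- Since `𝒟𝒮 = N𝒟`, the Leibniz rule turns `N(Q (n + 3))` into a divided difference, to which
    -- `w` applies through `v(Q 1 ·)`.
    have e1 : C (diffLead α (k + 1)) * N (Q (n + 3))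
        = divDiff α β γ ((divDiff α β γ ^ (k + 1)) (X * p (n + 3 + (k + 1)))
          - (C (avgLead α (k + 1)) * X + C b) * Q (n + 3)) := by
      rw [hb, add_sub_assoc, hQdef, sub_self, add_zero, divDiff_C_mul, divDiff_latticeAvg, hN]
      simp only [pow_succ', Module.End.mul_apply]
    -- The expansion of `X p (n + 3 + (k + 1))` in the `p i` starts at `i = n + 2 + (k + 1)`, so
    -- only `Q i` with `i ≥ 2` occur after `𝒟ᵏ⁺¹`.
    have e2 : v (Q 1 * ((divDiff α β γ ^ (k + 1)) (X * p (n + 3 + (k + 1))))) = 0 := by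
      have hX : X * p (n + 3 + (k + 1)) ∈ OrthogonalWith.tail u (n + 2 + (k + 1)) :=
        OrthogonalWith.mul_mem_tail natDegree_X_le (hp.mem_tail (by omega))
      have := hp.map_mem_of_mem_tail
        ((v.comp (LinearMap.mulLeft ℂ (Q 1))).comp (divDiff α β γ ^ (k + 1))) ⊥
        (fun i hi => (Submodule.mem_bot ℂ).mpr ?_) hX
      · exact (Submodule.mem_bot ℂ).mp this
      · obtain ⟨j, rfl⟩ : ∃ j, i = (j + 2) + (k + 1) := ⟨i - (k + 1) - 2, by omega⟩
        exact hQ.orthogonal 1 (j + 2) (by omega)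
    have e3 : v (Q 1 * ((C (avgLead α (k + 1)) * X + C b) * Q (n + 3))) = 0 := by
      rw [← mul_assoc, mul_comm]
      refine hQ.functional_mul_eq_zero ?_
      refine degree_le_natDegree.trans_lt ?_
      have h1 : (Q 1 * (C (avgLead α (k + 1)) * X + C b)).natDegree ≤ 1 + 1 :=
        natDegree_mul_le_of_le (hQ.natDegree_eq 1).le natDegree_linear_le
      rw [Nat.cast_lt]
      omega
    have e4 := congrArg w e1
    rw [hw, LinearMap.comp_apply, LinearMap.mulLeft_apply, mul_sub, map_sub, e2, e3, sub_zero,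
      ← smul_eq_C_mul, map_smul] at e4
    exact (smul_eq_zero.mp e4).resolve_left (hα k)
  let φ' : ℂ[X] := ∑ i ∈ Finset.range 3, C (w (N (Q i)) / v (Q i * Q i)) * Q i
  have hφ' (g : ℂ[X]) : w (N g) = v (φ' * g) := by
    suffices h : w.comp N = v.comp (LinearMap.mulLeft ℂ φ') from LinearMap.congr_fun h g
    refine hQ.basis.ext fun j => ?_
    rw [hQ.basis_apply, LinearMap.comp_apply, LinearMap.comp_apply, LinearMap.mulLeft_apply,
      Finset.sum_mul, map_sum]
    have ht (i : ℕ) : v (C (w (N (Q i)) / v (Q i * Q i)) * Q i * Q j)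
        = if i = j then w (N (Q j)) else 0 := by
      rw [mul_assoc, ← smul_eq_C_mul, map_smul, smul_eq_mul]
      split_ifs with h
      · rw [h, div_mul_cancel₀ _ (hQ.norm_ne_zero j)]
      · rw [hQ.orthogonal i j h, mul_zero]
    change w (N (Q j)) = ∑ i ∈ Finset.range 3, v (C (w (N (Q i)) / v (Q i * Q i)) * Q i * Q j)
    rw [Finset.sum_congr rfl fun i _ => ht i, Finset.sum_ite_eq']
    split_ifs with hj
    · rfl
    · obtain ⟨n, rfl⟩ : ∃ n, j = n + 3 := ⟨j - 3, by simp at hj; omega⟩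
      exact hsmall n
  have hφdeg : (-φ').natDegree ≤ 2 := by
    rw [natDegree_neg]
    refine natDegree_sum_le_of_forall_le _ _ fun i hi => ?_
    refine (natDegree_C_mul_le _ _).trans ?_
    rw [hQ.natDegree_eq i]
    simp at hi; omega
  have hψdeg : (Q 1).natDegree ≤ 1 := (hQ.natDegree_eq 1).le
  have hsym := functional_mul_latticeOp (φ := -φ') (ψ := Q 1) hw
    (fun g => by rw [← hN, hφ', neg_mul, map_neg, neg_neg])
  choose ev hev using hQ.eigen_of_symmetric
    (fun n f hf => (latticeOp_degree α β γ hφdeg hψdeg n f hf).1)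
    (fun f g => by rw [← hsym, ← hsym, mul_comm])
  refine ⟨-φ', Q 1, hφdeg, hψdeg, ev, ?_, hev⟩
  have h0 : ev 0 = 0 := by
    have h := hev 0
    have hQ0 : Q 0 = C ((Q 0).coeff 0) :=
      eq_C_of_natDegree_le_zero (hQ.natDegree_eq 0).le
    have hz : latticeOp α β γ (-φ') (Q 1) (Q 0) = 0 := by
      rw [hQ0]; simp [latticeOp_apply]
    have hne : Q 0 ≠ 0 := fun h0 => hQ.coeff_ne_zero 0 (by simp [h0])
    rw [hz, eq_comm, mul_eq_zero, or_iff_left hne, C_eq_zero] at h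
    exact h
  rw [h0]
  intro h1
  -- But `𝒟(Q 1)` is a nonzero constant, so this value is that constant times `w(𝒟(Q 1)) = v(Q 1 * Q
  -- 1) ≠ 0`.
  have h2 : w (divDiff α β γ (Q 1) * divDiff α β γ (Q 1)) = 0 := by
    rw [hsym, hev 1, ← h1, C_0, zero_mul, mul_zero, map_zero]
  have h3 := degree_divDiff (β := β) (γ := γ) hα (hQ.degree_eq 1)
  have h3' : divDiff α β γ (Q 1) = C ((divDiff α β γ (Q 1)).coeff 0) :=
    eq_C_of_degree_eq_zero h3
  have h4 : (divDiff α β γ (Q 1)).coeff 0 ≠ 0 := coeff_ne_zero_of_eq_degree h3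
  nth_rewrite 1 [h3'] at h2
  rw [← smul_eq_C_mul, map_smul, hw] at h2
  exact (smul_ne_zero h4 (hQ.norm_ne_zero 1)) h2

/-- The eigenvalues of a second order operator with orthogonal eigenvectors are distinct. -/
theorem latticeEigenvalue_injective (hα : ∀ n, diffLead α (n + 1) ≠ 0) (hp : OrthogonalWith p u)
    {φ ψ : ℂ[X]} (hne : φ.coeff 2 ≠ 0 ∨ ψ.coeff 1 ≠ 0)
    (hT : ∀ n, latticeOp α β γ φ ψ (p n)
      = C (latticeEigenvalue α (φ.coeff 2) (ψ.coeff 1) n) * p n) :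
    Function.Injective (latticeEigenvalue α (φ.coeff 2) (ψ.coeff 1)) := by
  have hsymm := hp.symmetric_of_eigen hT
  -- Symmetry together with `T 1 = 0`. As `𝒟` is onto, this one identity yields both Pearson
  -- equations for `u`.
  have hone (f : ℂ[X]) : u (latticeOp α β γ φ ψ f) = 0 := by
    have := hsymm f 1
    rw [one_mul] at this
    rw [this]; simp [latticeOp_apply]
  obtain ⟨w, hw⟩ := exists_functional_divDiff (β := β) (γ := γ) hα
    (u.comp (LinearMap.mulLeft ℂ ψ)) (by
      have := hone X
      simpa [latticeOp_apply] using this)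
  have hsurj := divDiff_surjective (β := β) (γ := γ) hα
  have hw2 (g : ℂ[X]) :
      w (C α * latticeAvg α β γ g + latticeDrift α β * divDiff α β γ g) = - u (φ * g) := by
    obtain ⟨f, rfl⟩ := hsurj g
    obtain ⟨F, rfl⟩ := hsurj f
    rw [← divDiff_latticeAvg, hw, eq_neg_iff_add_eq_zero, LinearMap.comp_apply,
      LinearMap.mulLeft_apply, ← map_add, add_comm]
    exact hone F
  have hsym := functional_mul_latticeOp hw hw2
  -- If this factor vanished, the eigenvalue of `p (j + 1)` would be `0` and `y = 𝒟 p (j + 1)` would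
  -- be `w`-orthogonal to every polynomial.
  have key (j : ℕ) : φ.coeff 2 * diffLead α j + ψ.coeff 1 * avgLead α j ≠ 0 := by
    intro hj
    have hy (f : ℂ[X]) : w (divDiff α β γ (p (j + 1)) * f) = 0 := by
      obtain ⟨g, rfl⟩ := hsurj f
      rw [hsym, hT, latticeEigenvalue_succ, hj, mul_zero, C_0, zero_mul, mul_zero, map_zero]
    set y := divDiff α β γ (p (j + 1)) with hydef
    have hydeg : y.degree = j := degree_divDiff hα (hp.degree_eq _)
    have hy0 : y ≠ 0 := fun h => by rw [h, degree_zero] at hydeg; exact WithBot.bot_ne_coe hydeg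
    set z := divDiff α β γ (p (j + 2)) with hzdef
    obtain ⟨R, hR⟩ := hsurj (z % y)
    have hRdeg : R.degree < (j + 2 : ℕ) := by
      have h := EuclideanDomain.mod_lt z hy0
      change (z % y).degree < y.degree at h
      rw [hydeg, ← hR] at h
      exact degree_le_natDegree.trans_lt
        (by exact_mod_cast (natDegree_le_of_divDiff hα h).trans_lt (by omega))
    have hzz : w (z * z) = 0 := by
      -- Division by `y`: the first term is killed by `w`, and the second is `w(𝒟p (j + 2) 𝒟R)` with
      -- `deg R < j + 2`, hence also zero. Thus the eigenvalue of `p (j + 2)` vanishes too.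
      have e : z * z = y * (z / y * z) + z * divDiff α β γ R := by
        rw [hR]
        linear_combination (-z) * EuclideanDomain.div_add_mod z y
      rw [e, map_add, hy, zero_add, hsym, hT, ← smul_eq_C_mul, mul_smul_comm, map_smul, mul_comm,
        hp.functional_mul_eq_zero hRdeg, smul_zero]
    rw [hsym, hT, ← smul_eq_C_mul, mul_smul_comm, map_smul, smul_eq_zero,
      or_iff_left (hp.norm_ne_zero _), latticeEigenvalue_succ, mul_eq_zero,
      or_iff_right (hα _)] at hzz
    have hsq := avgLead_sq α j
    rw [avgLead, diffLead] at hzz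
    -- The factors at `j` and `j + 1` give two homogeneous linear equations in the leading
    -- coefficients of `φ` and `ψ`, whose determinant is `-1` by `avgLead_sq`.
    rcases hne with hne | hne
    · refine hne ?_
      linear_combination (-φ.coeff 2) * hsq + avgLead α j * hzz
        - (α * avgLead α j + (α ^ 2 - 1) * diffLead α j) * hj
    · refine hne ?_
      linear_combination (-ψ.coeff 1) * hsq - diffLead α j * hzz
        + (avgLead α j + α * diffLead α j) * hj
  have hlt : ∀ m n, m < n → latticeEigenvalue α (φ.coeff 2) (ψ.coeff 1) m
      ≠ latticeEigenvalue α (φ.coeff 2) (ψ.coeff 1) n := by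
    intro m n hmn h
    obtain ⟨i, rfl⟩ : ∃ i, n = m + (i + 1) := ⟨n - m - 1, by omega⟩
    have := latticeEigenvalue_sub α (φ.coeff 2) (ψ.coeff 1) m i
    rw [h, sub_self] at this
    exact mul_ne_zero (hα i) (key _) this.symm
  intro m n h
  rcases lt_trichotomy m n with hmn | hmn | hmn
  · exact absurd h (hlt m n hmn)
  · exact hmn
  · exact absurd h.symm (hlt n m hmn)

/-- If an orthogonal sequence has an orthogonal sequence of `k`-th divided differences, then all its
divided differences are eigenfunctions of second order operators with distinct eigenvalues. -/
theorem exists_latticeOp_eigen_divDiff_pow (hα : ∀ n, diffLead α (n + 1) ≠ 0)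
    (hp : OrthogonalWith p u) (k : ℕ)
    (hQ : OrthogonalWith (fun n => (divDiff α β γ ^ (k + 1)) (p (n + (k + 1)))) v) (m : ℕ) :
    ∃ φ ψ : ℂ[X], φ.natDegree ≤ 2 ∧ ψ.natDegree ≤ 1 ∧ ∃ ev : ℕ → ℂ, Function.Injective ev ∧
      ∀ n, latticeOp α β γ φ ψ ((divDiff α β γ ^ m) (p (n + m)))
        = C (ev n) * (divDiff α β γ ^ m) (p (n + m)) := by
  obtain ⟨φ₁, ψ₁, hφ₁, hψ₁, ev₁, hev₁, h₁⟩ := exists_latticeOp_eigen hα hp k hQ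
  obtain ⟨φ, ψ, c, hφ, hψ, h⟩ := exists_latticeOp_lift_pow α β γ (k + 1) hφ₁ hψ₁
  set ev := latticeEigenvalue α (φ.coeff 2) (ψ.coeff 1) with hev
  have hdeg := latticeOp_degree α β γ hφ hψ
  have hlow (n : ℕ) : (latticeOp α β γ φ ψ (p (n + (k + 1)))
      - C (ev₁ n + c) * p (n + (k + 1))).degree < (k + 1 : ℕ) := by
    refine degree_lt_of_divDiff_pow_eq_zero hα (β := β) (γ := γ) _ ?_
    rw [map_sub, h, h₁, ← smul_eq_C_mul (ev₁ n + c), map_smul, smul_eq_C_mul, C_add]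
    ring
  have hval (n : ℕ) : ev (n + (k + 1)) = ev₁ n + c := by
    have hc := coeff_eq_zero_of_degree_lt ((hlow n).trans_le
      (by exact_mod_cast (by omega : k + 1 ≤ n + (k + 1))) : _ < ((n + (k + 1) : ℕ) : WithBot ℕ))
    rw [coeff_sub, coeff_C_mul, (hdeg _ _ (hp.natDegree_eq _).le).2, ← sub_mul, mul_eq_zero,
      or_iff_left (hp.coeff_ne_zero _), sub_eq_zero] at hc
    exact hc
  have hl := natDegree_latticeMean₂_le α β
  have hκ := natDegree_latticeNorm₂_le α β γ
  have hκ2 := coeff_latticeNorm₂ α β γ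
  have hπ := natDegree_latticeOp_inhomogeneity_le α β hφ hψ
  have heigen := hp.eigen_of_recursion (T := latticeOp α β γ φ ψ) (ev := ev) hl hκ hκ2 hπ
    (latticeOp_X_mul_X_mul α β γ φ ψ) (fun n => ?_) (k + 1) (fun n hn => ?_)
  rotate_left
  · rw [degree_lt_iff_coeff_zero]
    intro i hi
    have hd := hdeg n _ (hp.natDegree_eq n).le
    rw [coeff_sub, coeff_smul, smul_eq_mul]
    rcases hi.eq_or_lt with rfl | hi
    · rw [hd.2, sub_self]
    · rw [coeff_eq_zero_of_natDegree_lt (hd.1.trans_lt hi),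
        coeff_eq_zero_of_natDegree_lt ((hp.natDegree_eq n).trans_lt hi), mul_zero, sub_zero]
  · obtain ⟨i, rfl⟩ : ∃ i, n = i + (k + 1) := ⟨n - (k + 1), by omega⟩
    rw [hval, smul_eq_C_mul]
    exact hlow i
  simp only [smul_eq_C_mul] at heigen
  -- Otherwise all diagonal entries of the lifted operator are zero, against `ev₁ 0 ≠ ev₁ 1`.
  have hne : φ.coeff 2 ≠ 0 ∨ ψ.coeff 1 ≠ 0 := by
    by_contra! h0
    have hz (n : ℕ) : ev n = 0 := by rw [hev, h0.1, h0.2, latticeEigenvalue]; ring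
    have e0 := hval 0
    have e1 := hval 1
    rw [hz] at e0 e1
    exact hev₁ (by linear_combination e1 - e0)
  have hinj := latticeEigenvalue_injective hα hp hne heigen
  obtain ⟨φ', ψ', c', hφ', hψ', h'⟩ := exists_divDiff_pow_latticeOp α β γ m hφ hψ
  refine ⟨φ', ψ', hφ', hψ', fun n => ev (n + m) - c', fun a b hab => ?_, fun n => ?_⟩
  · exact Nat.add_right_cancel (hinj (sub_left_injective hab))
  · have e := h' (p (n + m))
    rw [heigen, ← smul_eq_C_mul, map_smul, smul_eq_C_mul] at e
    rw [C_sub]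
    linear_combination -e

end Orthogonal

/-! ### The Askey-Wilson polynomials as eigenfunctions -/

/-- `T` is determined by `T X = ψ` and a three-term recursion, as second order operators on a
quadratic lattice are. -/
structure SatisfiesRecursion (T : ℂ[X] →ₗ[ℂ] ℂ[X]) (l κ π ψ : ℂ[X]) : Prop where
  map_one : T 1 = 0
  map_X : T X = ψ
  map_X_mul_X_mul : ∀ f, T (X * (X * f)) = 2 * l * T (X * f) - κ * T f + π * f

section AskeyWilson

variable (q a b c d : ℂ)

/-- The polynomials `(a z, a / z; q)_k`. -/
def askeyWilsonBasis (k : ℕ) : ℂ[X] :=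
  ∏ j ∈ Finset.range k, (1 - C (2 * a * q ^ j) * X + C (a ^ 2 * q ^ (2 * j)))

theorem askeyWilsonBasis_succ (k : ℕ) : askeyWilsonBasis q a (k + 1)
    = askeyWilsonBasis q a k * (1 - C (2 * a * q ^ k) * X + C (a ^ 2 * q ^ (2 * k))) :=
  Finset.prod_range_succ _ _

variable {q a}

theorem degree_askeyWilsonBasis (hq : q ≠ 0) (ha : a ≠ 0) (k : ℕ) :
    (askeyWilsonBasis q a k).degree = k := by
  induction k with
  | zero => simp [askeyWilsonBasis]
  | succ k ih =>
    have h : (1 - C (2 * a * q ^ k) * X + C (a ^ 2 * q ^ (2 * k)) : ℂ[X])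
        = C (-(2 * a * q ^ k)) * X + C (1 + a ^ 2 * q ^ (2 * k)) := by
      simp only [C_neg, C_add, C_1]; ring
    rw [askeyWilsonBasis_succ, degree_mul, ih, h, degree_linear (by simp [ha, hq])]
    norm_cast

/-- The basis `(a z, a / z; q)_k` of `ℂ[X]`. -/
def askeyWilsonBasisOf (hq : q ≠ 0) (ha : a ≠ 0) : Module.Basis ℕ ℂ ℂ[X] :=
  Polynomial.Sequence.basis ⟨askeyWilsonBasis q a, degree_askeyWilsonBasis hq ha⟩ fun i =>
    (leadingCoeff_ne_zero.mpr (Polynomial.Sequence.ne_zero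
      ⟨askeyWilsonBasis q a, degree_askeyWilsonBasis hq ha⟩ i)).isUnit

theorem askeyWilsonBasisOf_apply (hq : q ≠ 0) (ha : a ≠ 0) (k : ℕ) :
    askeyWilsonBasisOf hq ha k = askeyWilsonBasis q a k :=
  Polynomial.Sequence.basis_eq_self ..

/-- The eigenvalues of the Askey-Wilson polynomials, where `e = a b c d`. -/
def askeyWilsonEigenvalue (q e : ℂ) (k : ℕ) : ℂ := ((q ^ k)⁻¹ - 1) * (1 - e * (q ^ k / q))

/-- The coefficients of the Askey-Wilson second order operator below the diagonal. -/
def askeyWilsonSubdiagonal (q a b c d : ℂ) (k : ℕ) : ℂ :=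
  (1 - (q ^ k)⁻¹) * (1 - a * b * (q ^ k / q)) * (1 - a * c * (q ^ k / q))
    * (1 - a * d * (q ^ k / q))

/-- The Askey-Wilson second order operator, given by its action on `(a z, a / z; q)_k`. -/
def askeyWilsonSecondOrder (hq : q ≠ 0) (ha : a ≠ 0) (b c d : ℂ) : ℂ[X] →ₗ[ℂ] ℂ[X] :=
  (askeyWilsonBasisOf hq ha).constr ℂ fun k =>
    C (askeyWilsonEigenvalue q (a * b * c * d) k) * askeyWilsonBasis q a k
      + C (askeyWilsonSubdiagonal q a b c d k) * askeyWilsonBasis q a (k - 1)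

/-- At `k = 0` the truncated index `k - 1` is harmless, because the subdiagonal coefficient contains
`1 - (q ^ k)⁻¹`. -/
theorem askeyWilsonSecondOrder_basis (hq : q ≠ 0) (ha : a ≠ 0) (b c d : ℂ) (k : ℕ) :
    askeyWilsonSecondOrder hq ha b c d (askeyWilsonBasis q a k)
      = C (askeyWilsonEigenvalue q (a * b * c * d) k) * askeyWilsonBasis q a k
        + C (askeyWilsonSubdiagonal q a b c d k) * askeyWilsonBasis q a (k - 1) := by
  conv_lhs => rw [← askeyWilsonBasisOf_apply hq ha k]
  rw [askeyWilsonSecondOrder, Module.Basis.constr_basis]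

/-- The polynomial coefficient `ψ` of the Askey-Wilson operator, in terms of the (homogenized)
elementary symmetric functions of the parameters. -/
def askeyWilsonPsi (q e₀ e₁ e₃ e₄ : ℂ) : ℂ[X] :=
  C ((q⁻¹ - 1) * (e₀ - e₄)) * X - C ((q⁻¹ - 1) * (e₁ - e₃) / 2)

/-- The inhomogeneous coefficient of the recursion for the Askey-Wilson operator, in terms of the
(homogenized) elementary symmetric functions of the parameters. -/
def askeyWilsonPi (q e₀ e₁ e₂ e₃ e₄ : ℂ) : ℂ[X] :=
  C ((q⁻¹ - 1) * (1 - q) * (1 + q⁻¹) / 4)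
      * (C (2 * (e₀ + e₄)) * X ^ 2 - C (e₁ + e₃) * X + C (e₂ - e₀ - e₄))
    - C ((1 - q) * (q⁻¹ - 1) / 2) * X * askeyWilsonPsi q e₀ e₁ e₃ e₄

theorem X_mul_askeyWilsonBasis (hq : q ≠ 0) (ha : a ≠ 0) (k : ℕ) :
    X * askeyWilsonBasis q a k = (2 * a * q ^ k)⁻¹ • ((1 + a ^ 2 * q ^ (2 * k)) •
      askeyWilsonBasis q a k - askeyWilsonBasis q a (k + 1)) := by
  have h : 2 * a * q ^ k ≠ 0 := by simp [ha, hq]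
  rw [askeyWilsonBasis_succ, eq_inv_smul_iff₀ h, smul_eq_C_mul, smul_eq_C_mul, C_add, C_1]
  ring

/-- Checked on the basis `(a z, a / z; q)_k`. The recursion has the shape of
`latticeOp_X_mul_X_mul`, so the two kinds of operators can be compared through `l`, `κ`, `π`, `ψ`
alone. -/
theorem askeyWilsonSecondOrder_recursion (hq : q ≠ 0) (ha : a ≠ 0) :
    SatisfiesRecursion (askeyWilsonSecondOrder hq ha b c d) (C ((q + q⁻¹) / 2) * X)
      (X ^ 2 + C (((q + q⁻¹) / 2) ^ 2 - 1))
      (askeyWilsonPi q 1 (a + b + c + d) (a * b + a * c + a * d + b * c + b * d + c * d)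
        (a * b * c + a * b * d + a * c * d + b * c * d) (a * b * c * d))
      (askeyWilsonPsi q 1 (a + b + c + d) (a * b * c + a * b * d + a * c * d + b * c * d)
        (a * b * c * d)) := by
  set T := askeyWilsonSecondOrder hq ha b c d with hTdef
  have hT := askeyWilsonSecondOrder_basis hq ha b c d
  have h0 : T 1 = 0 := by
    have := hT 0
    simpa [askeyWilsonBasis, askeyWilsonEigenvalue, askeyWilsonSubdiagonal] using this
  have hX (k : ℕ) : T (X * askeyWilsonBasis q a k) = (2 * a * q ^ k)⁻¹ •
      ((1 + a ^ 2 * q ^ (2 * k)) • T (askeyWilsonBasis q a k)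
        - T (askeyWilsonBasis q a (k + 1))) := by
    rw [X_mul_askeyWilsonBasis hq ha, map_smul, map_sub, map_smul]
  have hXX (k : ℕ) : T (X * (X * askeyWilsonBasis q a k)) = (2 * a * q ^ k)⁻¹ •
      ((1 + a ^ 2 * q ^ (2 * k)) • T (X * askeyWilsonBasis q a k)
        - T (X * askeyWilsonBasis q a (k + 1))) := by
    conv_lhs => rw [X_mul_askeyWilsonBasis hq ha, mul_smul_comm, mul_sub, mul_smul_comm]
    rw [map_smul, map_sub, map_smul]
  refine ⟨h0, ?_, fun f => ?_⟩
  · have h := hX 0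
    rw [show X * askeyWilsonBasis q a 0 = X by simp [askeyWilsonBasis], hT, hT] at h
    rw [h]
    refine Polynomial.funext fun t => ?_
    simp only [askeyWilsonBasis, askeyWilsonEigenvalue, askeyWilsonSubdiagonal, askeyWilsonPsi,
      Finset.prod_range_zero, Finset.prod_range_one, eval_smul, eval_sub, eval_add, eval_mul,
      eval_C, eval_X, eval_one, smul_eq_mul, Nat.sub_self, zero_add, pow_zero, pow_one, mul_zero,
      mul_one, zero_le, Nat.sub_eq_zero_of_le]
    field_simp
    ring
  · suffices h : T.comp ((LinearMap.mulLeft ℂ X).comp (LinearMap.mulLeft ℂ X))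
        = (LinearMap.mulLeft ℂ (2 * (C ((q + q⁻¹) / 2) * X))).comp (T.comp (LinearMap.mulLeft ℂ X))
          - (LinearMap.mulLeft ℂ (X ^ 2 + C (((q + q⁻¹) / 2) ^ 2 - 1))).comp T
          + LinearMap.mulLeft ℂ (askeyWilsonPi q 1 (a + b + c + d)
              (a * b + a * c + a * d + b * c + b * d + c * d)
              (a * b * c + a * b * d + a * c * d + b * c * d) (a * b * c * d)) from
      LinearMap.congr_fun h f
    refine (askeyWilsonBasisOf hq ha).ext fun k => ?_
    rw [askeyWilsonBasisOf_apply]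
    simp only [LinearMap.add_apply, LinearMap.sub_apply, LinearMap.comp_apply,
      LinearMap.mulLeft_apply]
    rw [hXX, hX, hX, hT, hT, hT]
    refine Polynomial.funext fun t => ?_
    cases k with
    | zero =>
      simp only [askeyWilsonBasis, askeyWilsonEigenvalue, askeyWilsonSubdiagonal, askeyWilsonPi,
        askeyWilsonPsi, Finset.prod_range_zero, Finset.prod_range_succ,
        eval_smul, eval_sub, eval_add,
        eval_mul, eval_C, eval_X, eval_one, eval_pow, eval_ofNat, smul_eq_mul, Nat.sub_self,
        zero_add, pow_zero, pow_one, mul_zero, mul_one, one_mul, Nat.add_sub_cancel]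
      field_simp
      ring
    | succ j =>
      simp only [askeyWilsonBasis_succ, askeyWilsonEigenvalue, askeyWilsonSubdiagonal,
        askeyWilsonPi, askeyWilsonPsi, eval_smul, eval_sub, eval_add,
        eval_mul, eval_C, eval_X, eval_one, eval_ofNat, smul_eq_mul,
        Nat.add_sub_cancel, pow_succ, pow_mul, mul_add, pow_zero, one_mul]
      generalize eval t (askeyWilsonBasis q a j) = G
      have hQ : q ^ j ≠ 0 := pow_ne_zero _ hq
      rw [show (q * q) ^ j = q ^ j * q ^ j by rw [mul_pow]]
      generalize q ^ j = Q at hQ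
      field_simp
      ring

end AskeyWilson

-- The Askey-Wilson polynomials diagonalize the second order operator

section Eigenpolynomials

theorem qShiftedFactorial_succ (a q : ℂ) (n : ℕ) :
    qShiftedFactorial a q (n + 1) = qShiftedFactorial a q n * (1 - a * q ^ n) :=
  Finset.prod_range_succ _ _

theorem qShiftedFactorial_succ' (a q : ℂ) (n : ℕ) :
    qShiftedFactorial a q (n + 1) = (1 - a) * qShiftedFactorial (a * q) q n := by
  simp only [qShiftedFactorial]
  rw [Finset.prod_range_succ', mul_comm]
  simp only [pow_zero, mul_one, pow_succ', mul_assoc]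

theorem qShiftedFactorial_ne_zero {a q : ℂ} {n : ℕ} (h : ∀ j < n, a * q ^ j ≠ 1) :
    qShiftedFactorial a q n ≠ 0 :=
  Finset.prod_ne_zero_iff.mpr fun j hj => sub_ne_zero.mpr (h j (Finset.mem_range.mp hj)).symm

variable {q a : ℂ}

/-- The coefficients of the Askey-Wilson polynomials in the basis `(a z, a / z; q)_k`. -/
def askeyWilsonCoeff (q a b c d : ℂ) (n k : ℕ) : ℂ :=
  qShiftedFactorial (q ^ (-(n : ℤ))) q k
    * qShiftedFactorial (a * b * c * d * q ^ ((n : ℤ) - 1)) q k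
    / qShiftedFactorial q q k * q ^ k
    * qShiftedFactorial (a * b * q ^ k) q (n - k)
    * qShiftedFactorial (a * c * q ^ k) q (n - k)
    * qShiftedFactorial (a * d * q ^ k) q (n - k)

theorem askeyWilsonPoly_eq (q a b c d : ℂ) (n : ℕ) : askeyWilsonPoly q a b c d n
    = C ((a ^ n)⁻¹) * ∑ k ∈ Finset.range (n + 1),
        C (askeyWilsonCoeff q a b c d n k) * askeyWilsonBasis q a k := rfl

/-- The eigenvalue equation compared at the `k`-th basis element, where only the coefficients of
index `k` and `k + 1` enter. -/
theorem askeyWilsonCoeff_succ (hq : q ≠ 0) (hq1 : ∀ j : ℕ, q ^ (j + 1) ≠ 1) (a b c d : ℂ)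
    {n k : ℕ} (hk : k < n) :
    askeyWilsonCoeff q a b c d n (k + 1) * askeyWilsonSubdiagonal q a b c d (k + 1)
      = (askeyWilsonEigenvalue q (a * b * c * d) n - askeyWilsonEigenvalue q (a * b * c * d) k)
        * askeyWilsonCoeff q a b c d n k := by
  obtain ⟨i, rfl⟩ : ∃ i, n = k + (i + 1) := ⟨n - k - 1, by omega⟩
  have h1 : k + (i + 1) - (k + 1) = i := by omega
  have h2 : k + (i + 1) - k = i + 1 := by omega
  have hz : q ^ (-((k + (i + 1) : ℕ) : ℤ)) = (q ^ k * q ^ (i + 1))⁻¹ := by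
    rw [zpow_neg, zpow_natCast, pow_add]
  have hz' : q ^ (((k + (i + 1) : ℕ) : ℤ) - 1) = q ^ k * q ^ i := by
    rw [zpow_sub_one₀ hq, zpow_natCast, pow_add, pow_succ]; field_simp
  rw [askeyWilsonCoeff, askeyWilsonCoeff, h1, h2]
  simp only [qShiftedFactorial_succ' (_ * q ^ k) q i]
  simp only [qShiftedFactorial_succ _ q k, hz, hz', askeyWilsonSubdiagonal, askeyWilsonEigenvalue,
    mul_assoc _ (q ^ k) q, ← pow_succ]
  have hF : qShiftedFactorial q q k ≠ 0 :=
    qShiftedFactorial_ne_zero fun j _ => by rw [← pow_succ']; exact hq1 j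
  have hF1 : 1 - q ^ (k + 1) ≠ 0 := sub_ne_zero.mpr (hq1 k).symm
  rw [← pow_succ' q k]
  generalize qShiftedFactorial q q k = F at hF
  generalize qShiftedFactorial (q ^ k * q ^ (i + 1))⁻¹ q k = F₁
  generalize qShiftedFactorial (a * b * c * d * (q ^ k * q ^ i)) q k = F₂
  generalize qShiftedFactorial (a * b * q ^ (k + 1)) q i = F₃
  generalize qShiftedFactorial (a * c * q ^ (k + 1)) q i = F₄
  generalize qShiftedFactorial (a * d * q ^ (k + 1)) q i = F₅
  have hQ : q ^ k ≠ 0 := pow_ne_zero _ hq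
  have hP : q ^ i ≠ 0 := pow_ne_zero _ hq
  simp only [pow_succ, pow_add] at hF1 ⊢
  generalize q ^ k = Q at *
  generalize q ^ i = P at *
  field_simp
  ring

theorem askeyWilsonSecondOrder_askeyWilsonPoly (hq : q ≠ 0) (hq1 : ∀ j : ℕ, q ^ (j + 1) ≠ 1)
    (ha : a ≠ 0) (b c d : ℂ) (n : ℕ) :
    askeyWilsonSecondOrder hq ha b c d (askeyWilsonPoly q a b c d n)
      = C (askeyWilsonEigenvalue q (a * b * c * d) n) * askeyWilsonPoly q a b c d n := by
  rw [askeyWilsonPoly_eq, ← smul_eq_C_mul ((a ^ n)⁻¹), map_smul, mul_smul_comm, map_sum]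
  congr 1
  simp only [← smul_eq_C_mul (askeyWilsonCoeff q a b c d n _), map_smul,
    askeyWilsonSecondOrder_basis, smul_add, Finset.sum_add_distrib]
  have h : ∑ k ∈ Finset.range (n + 1), askeyWilsonCoeff q a b c d n k •
        (C (askeyWilsonSubdiagonal q a b c d k) * askeyWilsonBasis q a (k - 1))
      = ∑ k ∈ Finset.range (n + 1), ((askeyWilsonEigenvalue q (a * b * c * d) n
          - askeyWilsonEigenvalue q (a * b * c * d) k) * askeyWilsonCoeff q a b c d n k) •
            askeyWilsonBasis q a k := by
    rw [Finset.sum_range_succ', Finset.sum_range_succ (n := n), sub_self, zero_mul, zero_smul]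
    congr 1
    · refine Finset.sum_congr rfl fun k hk => ?_
      rw [← askeyWilsonCoeff_succ hq hq1 a b c d (Finset.mem_range.mp hk), ← smul_eq_C_mul,
        smul_smul, Nat.add_sub_cancel]
    · simp [askeyWilsonSubdiagonal]
  rw [h, ← Finset.sum_add_distrib, Finset.mul_sum]
  refine Finset.sum_congr rfl fun k _ => ?_
  simp only [smul_eq_C_mul, map_mul, map_sub]
  ring

theorem natDegree_askeyWilsonBasis (hq : q ≠ 0) (ha : a ≠ 0) (k : ℕ) :
    (askeyWilsonBasis q a k).natDegree = k :=
  natDegree_eq_of_degree_eq_some (degree_askeyWilsonBasis hq ha k)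

theorem natDegree_askeyWilsonPoly_le (hq : q ≠ 0) (ha : a ≠ 0) (b c d : ℂ) (n : ℕ) :
    (askeyWilsonPoly q a b c d n).natDegree ≤ n := by
  rw [askeyWilsonPoly_eq]
  refine (natDegree_C_mul_le _ _).trans (natDegree_sum_le_of_forall_le _ _ fun k hk => ?_)
  refine (natDegree_C_mul_le _ _).trans ?_
  rw [natDegree_askeyWilsonBasis hq ha]
  exact Nat.lt_succ_iff.mp (Finset.mem_range.mp hk)

/-- A zero factor of `(abcd q^(n-1); q)_n` in the top coefficient would make the `n`-th eigenvalue
coincide with an earlier one. -/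
theorem degree_askeyWilsonPoly (hq : q ≠ 0) (hq1 : ∀ j : ℕ, q ^ (j + 1) ≠ 1) (ha : a ≠ 0)
    {b c d : ℂ} {n : ℕ} (hn : ∀ i < n, askeyWilsonEigenvalue q (a * b * c * d) i
      ≠ askeyWilsonEigenvalue q (a * b * c * d) n) :
    (askeyWilsonPoly q a b c d n).degree = n := by
  refine degree_eq_of_le_of_coeff_ne_zero
    (natDegree_le_iff_degree_le.mp (natDegree_askeyWilsonPoly_le hq ha b c d n)) ?_
  rw [askeyWilsonPoly_eq, coeff_C_mul, finsetSum_coeff, Finset.sum_range_succ,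
    Finset.sum_eq_zero, zero_add, coeff_C_mul]
  · refine mul_ne_zero (inv_ne_zero (pow_ne_zero _ ha)) (mul_ne_zero ?_
      (coeff_ne_zero_of_eq_degree (degree_askeyWilsonBasis hq ha n)))
    have h1 : qShiftedFactorial (q ^ (-(n : ℤ))) q n ≠ 0 := by
      refine qShiftedFactorial_ne_zero fun j hj h => ?_
      obtain ⟨i, rfl⟩ : ∃ i, n = j + (i + 1) := ⟨n - j - 1, by omega⟩
      rw [zpow_neg, zpow_natCast, pow_add, mul_inv, mul_comm, mul_inv_cancel_left₀
        (pow_ne_zero _ hq), inv_eq_one] at h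
      exact hq1 i h
    have h2 : qShiftedFactorial (a * b * c * d * q ^ ((n : ℤ) - 1)) q n ≠ 0 := by
      refine qShiftedFactorial_ne_zero fun j hj h => hn j hj ?_
      rw [zpow_sub_one₀ hq, zpow_natCast] at h
      have hQ : q ^ j ≠ 0 := pow_ne_zero _ hq
      have hP : q ^ n ≠ 0 := pow_ne_zero _ hq
      rw [askeyWilsonEigenvalue, askeyWilsonEigenvalue]
      generalize a * b * c * d = e at h
      field_simp at h ⊢
      linear_combination (q ^ j - q ^ n) * h
    have h3 : qShiftedFactorial q q n ≠ 0 :=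
      qShiftedFactorial_ne_zero fun j _ => by rw [← pow_succ']; exact hq1 j
    rw [askeyWilsonCoeff, Nat.sub_self]
    simp [qShiftedFactorial] at h1 h2 h3 ⊢
    simp [h1, h2, h3, hq]
  · intro k hk
    rw [coeff_C_mul, coeff_eq_zero_of_natDegree_lt, mul_zero]
    rw [natDegree_askeyWilsonBasis hq ha]
    exact Finset.mem_range.mp hk

end Eigenpolynomials

/-! ### Triangular operators -/

theorem coeff_map_eq_sum (T : ℂ[X] →ₗ[ℂ] ℂ[X]) {f : ℂ[X]} {n : ℕ} (hf : f.natDegree ≤ n) (i : ℕ) :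
    (T f).coeff i = ∑ k ∈ Finset.range (n + 1), f.coeff k * (T (X ^ k)).coeff i := by
  conv_lhs => rw [f.as_sum_range' (n + 1) (Nat.lt_succ_of_le hf)]
  rw [map_sum, finsetSum_coeff]
  refine Finset.sum_congr rfl fun k _ => ?_
  rw [← C_mul_X_pow_eq_monomial, ← smul_eq_C_mul, map_smul, coeff_smul, smul_eq_mul]

theorem coeff_map_top {T : ℂ[X] →ₗ[ℂ] ℂ[X]} (hT : ∀ n, (T (X ^ n)).natDegree ≤ n) {f : ℂ[X]}
    {n : ℕ} (hf : f.natDegree ≤ n) : (T f).coeff n = f.coeff n * (T (X ^ n)).coeff n := by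
  rw [coeff_map_eq_sum T hf, Finset.sum_range_succ, Finset.sum_eq_zero, zero_add]
  intro k hk
  rw [coeff_eq_zero_of_natDegree_lt (p := T (X ^ k)), mul_zero]
  exact (hT k).trans_lt (Finset.mem_range.mp hk)

theorem SatisfiesRecursion.natDegree_le {T : ℂ[X] →ₗ[ℂ] ℂ[X]} {l κ π ψ : ℂ[X]}
    (h : SatisfiesRecursion T l κ π ψ) (hl : l.natDegree ≤ 1) (hκ : κ.natDegree ≤ 2)
    (hπ : π.natDegree ≤ 2) (hψ : ψ.natDegree ≤ 1) (n : ℕ) : (T (X ^ n)).natDegree ≤ n := by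
  induction n using Nat.strong_induction_on with
  | _ n ih =>
    match n with
    | 0 => simp [h.map_one]
    | 1 => rw [pow_one, h.map_X]; exact hψ
    | n + 2 =>
      rw [pow_succ', pow_succ', h.map_X_mul_X_mul, ← pow_succ']
      have h1 := ih (n + 1) (by omega)
      have h0 := ih n (by omega)
      have h2l : (2 * l).natDegree ≤ 1 :=
        (natDegree_mul_le_of_le (natDegree_ofNat 2).le hl).trans (by omega)
      refine natDegree_add_le_of_degree_le ((natDegree_sub_le_of_le (natDegree_mul_le_of_le h2l h1)
        (natDegree_mul_le_of_le hκ h0)).trans (by omega)) ?_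
      exact (natDegree_mul_le_of_le hπ (natDegree_X_pow_le n)).trans (by omega)

/-! ### Convergence -/

namespace TendstoPoly

theorem const (f : ℂ[X]) : TendstoPoly (fun _ => f) f := fun _ => tendsto_const_nhds

theorem add {f g : ℕ → ℂ[X]} {F G : ℂ[X]} (hf : TendstoPoly f F) (hg : TendstoPoly g G) :
    TendstoPoly (fun j => f j + g j) (F + G) := fun i => by
  simpa using (hf i).add (hg i)

theorem sub {f g : ℕ → ℂ[X]} {F G : ℂ[X]} (hf : TendstoPoly f F) (hg : TendstoPoly g G) :
    TendstoPoly (fun j => f j - g j) (F - G) := fun i => by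
  simpa using (hf i).sub (hg i)

theorem mul {f g : ℕ → ℂ[X]} {F G : ℂ[X]} (hf : TendstoPoly f F) (hg : TendstoPoly g G) :
    TendstoPoly (fun j => f j * g j) (F * G) := fun i => by
  simp only [coeff_mul]
  exact tendsto_finsetSum _ fun x _ => (hf _).mul (hg _)

theorem C {c : ℕ → ℂ} {c₀ : ℂ} (hc : Tendsto c atTop (𝓝 c₀)) :
    TendstoPoly (fun j => Polynomial.C (c j)) (Polynomial.C c₀) := fun i => by
  simp only [coeff_C]
  split_ifs
  · exact hc
  · exact tendsto_const_nhds

theorem unique {f : ℕ → ℂ[X]} {F G : ℂ[X]} (hF : TendstoPoly f F) (hG : TendstoPoly f G) : F = G :=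
  Polynomial.ext fun i => tendsto_nhds_unique (hF i) (hG i)

end TendstoPoly

theorem SatisfiesRecursion.tendsto {T : ℕ → ℂ[X] →ₗ[ℂ] ℂ[X]} {T₀ : ℂ[X] →ₗ[ℂ] ℂ[X]}
    {l κ π ψ : ℕ → ℂ[X]} {l₀ κ₀ π₀ ψ₀ : ℂ[X]}
    (h : ∀ j, SatisfiesRecursion (T j) (l j) (κ j) (π j) (ψ j))
    (h₀ : SatisfiesRecursion T₀ l₀ κ₀ π₀ ψ₀) (hl : TendstoPoly l l₀) (hκ : TendstoPoly κ κ₀)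
    (hπ : TendstoPoly π π₀) (hψ : TendstoPoly ψ ψ₀) (n : ℕ) :
    TendstoPoly (fun j => T j (X ^ n)) (T₀ (X ^ n)) := by
  induction n using Nat.strong_induction_on with
  | _ n ih =>
    match n with
    | 0 => simp only [pow_zero, (h _).map_one, h₀.map_one]; exact .const 0
    | 1 => simp only [pow_one, (h _).map_X, h₀.map_X]; exact hψ
    | n + 2 =>
      have h1 := ih (n + 1) (by omega)
      have h0 := ih n (by omega)
      simp only [pow_succ' _ (n + 1), pow_succ' _ n] at h1 ⊢
      simp only [(h _).map_X_mul_X_mul, h₀.map_X_mul_X_mul]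
      exact ((((TendstoPoly.const 2).mul hl).mul h1).sub (hκ.mul h0)).add (hπ.mul (.const _))

/-- With the leading coefficient fixed, the eigenvalue equation determines the lower coefficients
successively by division by differences of diagonal entries, which stay away from zero in the limit.
-/
theorem tendstoPoly_of_eigen {T : ℕ → ℂ[X] →ₗ[ℂ] ℂ[X]} {T₀ : ℂ[X] →ₗ[ℂ] ℂ[X]}
    (hT : ∀ j n, (T j (X ^ n)).natDegree ≤ n) (hT₀ : ∀ n, (T₀ (X ^ n)).natDegree ≤ n)
    (hconv : ∀ n, TendstoPoly (fun j => T j (X ^ n)) (T₀ (X ^ n))) {n : ℕ}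
    (hne : ∀ i < n, (T₀ (X ^ i)).coeff i ≠ (T₀ (X ^ n)).coeff n) {f : ℕ → ℂ[X]} {y : ℂ[X]}
    (hf : ∀ j, (f j).natDegree ≤ n) (hy : y.natDegree ≤ n)
    (hlead : ∀ᶠ j in atTop, (f j).coeff n = y.coeff n)
    (hTf : ∀ j, T j (f j) = C ((T j (X ^ n)).coeff n) * f j)
    (hTy : T₀ y = C ((T₀ (X ^ n)).coeff n) * y) : TendstoPoly f y := by
  have hsolve {S : ℂ[X] →ₗ[ℂ] ℂ[X]} (hS : ∀ n, (S (X ^ n)).natDegree ≤ n) {g : ℂ[X]}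
      (hg : g.natDegree ≤ n) (hSg : S g = C ((S (X ^ n)).coeff n) * g) {i : ℕ} (hi : i < n) :
      ((S (X ^ n)).coeff n - (S (X ^ i)).coeff i) * g.coeff i
        = ∑ k ∈ Finset.Ico (i + 1) (n + 1), g.coeff k * (S (X ^ k)).coeff i := by
    have h := congrArg (fun r => r.coeff i) hSg
    simp only [coeff_C_mul] at h
    rw [coeff_map_eq_sum S hg, ← Finset.sum_range_add_sum_Ico _ (by omega : i ≤ n + 1),
      Finset.sum_eq_zero, zero_add, Finset.sum_eq_sum_Ico_succ_bot (by omega)] at h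
    · rw [sub_mul, ← h, mul_comm (g.coeff i), add_sub_cancel_left]
    · intro k hk
      rw [coeff_eq_zero_of_natDegree_lt ((hS k).trans_lt (Finset.mem_range.mp hk)), mul_zero]
  have main : ∀ m i, n ≤ i + m → Tendsto (fun j => (f j).coeff i) atTop (𝓝 (y.coeff i)) := by
    intro m
    induction m with
    | zero =>
      intro i hi
      rw [add_zero] at hi
      rcases hi.eq_or_lt with rfl | hi
      · exact tendsto_const_nhds.congr' (hlead.mono fun j hj => hj.symm)
      · rw [coeff_eq_zero_of_natDegree_lt (hy.trans_lt hi)]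
        simp only [coeff_eq_zero_of_natDegree_lt ((hf _).trans_lt hi)]
        exact tendsto_const_nhds
    | succ m ih =>
      intro i him
      by_cases hi : n ≤ i
      · exact ih i (by omega)
      push Not at hi
      have hd : Tendsto (fun j => (T j (X ^ n)).coeff n - (T j (X ^ i)).coeff i) atTop
          (𝓝 ((T₀ (X ^ n)).coeff n - (T₀ (X ^ i)).coeff i)) := (hconv n n).sub (hconv i i)
      have hd0 : (T₀ (X ^ n)).coeff n - (T₀ (X ^ i)).coeff i ≠ 0 :=
        sub_ne_zero.mpr (hne i hi).symm
      have hs : Tendsto (fun j => ∑ k ∈ Finset.Ico (i + 1) (n + 1), (f j).coeff k * (T j (X ^ k)).coeff i) atTop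
          (𝓝 (∑ k ∈ Finset.Ico (i + 1) (n + 1), y.coeff k * (T₀ (X ^ k)).coeff i)) :=
        tendsto_finsetSum _ fun k hk =>
          (ih k (by have := (Finset.mem_Ico.mp hk).1; omega)).mul (hconv k i)
      have hq := hs.div hd hd0
      rw [← hsolve hT₀ hy hTy hi, mul_div_cancel_left₀ _ hd0] at hq
      refine hq.congr' ?_
      filter_upwards [hd.eventually_ne hd0] with j hj
      rw [Pi.div_apply, ← hsolve (hT j) (hf j) (hTf j) hi, mul_div_cancel_left₀ _ hj]
  exact fun i => main n i (by omega)

/-! ### Affine substitutions -/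

/-- The substitution `f ↦ f(a x + b)`. -/
def affineSubst (a b : ℂ) : ℂ[X] →ₐ[ℂ] ℂ[X] := aeval (C a * X + C b)

theorem affineSubst_apply (a b : ℂ) (f : ℂ[X]) : affineSubst a b f = f.comp (C a * X + C b) := rfl

@[simp] theorem affineSubst_X (a b : ℂ) : affineSubst a b X = C a * X + C b := aeval_X _

@[simp] theorem affineSubst_C (a b c : ℂ) : affineSubst a b (C c) = C c := aeval_C _ c

theorem affineSubst_affineSubst (a b a' b' : ℂ) (f : ℂ[X]) :
    affineSubst a b (affineSubst a' b' f) = affineSubst (a' * a) (a' * b + b') f := by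
  simp only [affineSubst_apply, comp_assoc]
  congr 1
  simp only [add_comp, mul_comp, C_comp, X_comp, C_add, C_mul]
  ring

theorem affineSubst_one_zero (f : ℂ[X]) : affineSubst 1 0 f = f := by
  simp [affineSubst_apply]

theorem affineSubst_inv_apply {a : ℂ} (ha : a ≠ 0) (b : ℂ) (f : ℂ[X]) :
    affineSubst a b (affineSubst a⁻¹ (-(a⁻¹ * b)) f) = f := by
  rw [affineSubst_affineSubst, inv_mul_cancel₀ ha, add_neg_cancel, affineSubst_one_zero]

theorem affineSubst_apply_inv {a : ℂ} (ha : a ≠ 0) (b : ℂ) (f : ℂ[X]) :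
    affineSubst a⁻¹ (-(a⁻¹ * b)) (affineSubst a b f) = f := by
  rw [affineSubst_affineSubst, mul_inv_cancel₀ ha, mul_neg, mul_inv_cancel_left₀ ha,
    neg_add_cancel, affineSubst_one_zero]

theorem degree_affineSubst {a : ℂ} (ha : a ≠ 0) (b : ℂ) (f : ℂ[X]) :
    (affineSubst a b f).degree = f.degree := by
  by_cases hf : f = 0
  · rw [hf, map_zero]
  have hne : affineSubst a b f ≠ 0 := fun h => hf (by
    rw [← affineSubst_apply_inv ha b f, h, map_zero])
  rw [degree_eq_natDegree hne, degree_eq_natDegree hf, affineSubst_apply, natDegree_comp,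
    natDegree_linear ha, mul_one]

theorem natDegree_affineSubst_le (a b : ℂ) (f : ℂ[X]) :
    (affineSubst a b f).natDegree ≤ f.natDegree := by
  rw [affineSubst_apply, natDegree_comp]
  exact (Nat.mul_le_mul_left _ natDegree_linear_le).trans (mul_one _).le

/-- The operator `T`, conjugated by an affine substitution. -/
def affineConj (A B : ℂ) (T : ℂ[X] →ₗ[ℂ] ℂ[X]) : ℂ[X] →ₗ[ℂ] ℂ[X] :=
  (affineSubst A B).toLinearMap.comp (T.comp (affineSubst A⁻¹ (-(A⁻¹ * B))).toLinearMap)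

theorem affineConj_apply (A B : ℂ) (T : ℂ[X] →ₗ[ℂ] ℂ[X]) (f : ℂ[X]) :
    affineConj A B T f = affineSubst A B (T (affineSubst A⁻¹ (-(A⁻¹ * B)) f)) := rfl

theorem affineConj_affineSubst {A : ℂ} (hA : A ≠ 0) (B : ℂ) (T : ℂ[X] →ₗ[ℂ] ℂ[X]) (f : ℂ[X]) :
    affineConj A B T (affineSubst A B f) = affineSubst A B (T f) := by
  rw [affineConj_apply, affineSubst_apply_inv hA]

theorem SatisfiesRecursion.smul {T : ℂ[X] →ₗ[ℂ] ℂ[X]} {l κ π ψ : ℂ[X]}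
    (h : SatisfiesRecursion T l κ π ψ) (s : ℂ) :
    SatisfiesRecursion (s • T) l κ (C s * π) (C s * ψ) where
  map_one := by rw [LinearMap.smul_apply, h.map_one, smul_zero]
  map_X := by rw [LinearMap.smul_apply, h.map_X, smul_eq_C_mul]
  map_X_mul_X_mul f := by
    simp only [LinearMap.smul_apply, h.map_X_mul_X_mul, smul_eq_C_mul]; ring

/-- The half-sum `l` and the product `κ` of two points transform as the points do under `t ↦ (t - B)
/ A`. -/
theorem SatisfiesRecursion.affineConj {T : ℂ[X] →ₗ[ℂ] ℂ[X]} {l κ π ψ : ℂ[X]}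
    (h : SatisfiesRecursion T l κ π ψ) {A : ℂ} (hA : A ≠ 0) (B : ℂ) :
    SatisfiesRecursion (affineConj A B T)
      (C A⁻¹ * (affineSubst A B l - C B))
      (C (A⁻¹ ^ 2) * (affineSubst A B κ - C (2 * B) * affineSubst A B l + C (B ^ 2)))
      (C (A⁻¹ ^ 2) * affineSubst A B π) (C A⁻¹ * affineSubst A B ψ) := by
  have hC (c : ℂ) (f : ℂ[X]) : T (C c * f) = C c * T f := by
    rw [← smul_eq_C_mul, map_smul, smul_eq_C_mul]
  have hY (f : ℂ[X]) : T ((C A⁻¹ * X + C (-(A⁻¹ * B))) * f) = C A⁻¹ * (T (X * f) - C B * T f) := by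
    rw [add_mul, map_add, mul_assoc, hC, hC, C_neg, C_mul]; ring
  refine ⟨?_, ?_, fun f => ?_⟩
  · simp [affineConj_apply, h.map_one]
  · have := hY 1
    simp only [mul_one, h.map_one, h.map_X, mul_zero, sub_zero] at this
    rw [affineConj_apply, affineSubst_X, this, map_mul, affineSubst_C]
  · simp only [affineConj_apply, map_mul, affineSubst_X]
    rw [hY, mul_left_comm, hY, hY]
    simp only [h.map_X_mul_X_mul, map_mul, map_sub, map_add, affineSubst_C, map_pow, map_ofNat,
      affineSubst_inv_apply hA]
    ring

/-! ### The lattices of the rescaled Askey-Wilson operators -/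

/-- The parameter `α` of the lattice of the Askey-Wilson operator with base `q`. -/
def awAlpha (q : ℝ) : ℂ := (((√q : ℝ) : ℂ) + ((√q : ℝ) : ℂ)⁻¹) / 2

/-- The parameter `β` of the lattice of a rescaled Askey-Wilson operator. -/
def awBeta (q : ℝ) (A B : ℂ) : ℂ := (awAlpha q - 1) * B / A

/-- The parameter `γ` of the lattice of a rescaled Askey-Wilson operator. -/
def awGamma (q : ℝ) (A B : ℂ) : ℂ :=
  (awAlpha q - 1) * (awAlpha q + 1 - 2 * B ^ 2) / A ^ 2

/-- For `x = (z + 1/z) / 2` the two shifted points have half-sum `αx` and product `x² + α² - 1`, so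
`β = 0` and `γ = α² - 1`. -/
theorem askeyWilsonMonomial_eq (q : ℝ) (n : ℕ) :
    askeyWilsonMonomial ((√q : ℝ) : ℂ) n
      = (divDiff (awAlpha q) 0 (awAlpha q ^ 2 - 1) (X ^ n),
        latticeAvg (awAlpha q) 0 (awAlpha q ^ 2 - 1) (X ^ n)) := by
  induction n with
  | zero => simp [askeyWilsonMonomial]
  | succ n ih =>
    rw [askeyWilsonMonomial, ih, pow_succ' (X : ℂ[X]) n, divDiff_X_mul, latticeAvg_X_mul, ← awAlpha]
    simp only [latticeMean, latticeDisc_eq, Prod.mk.injEq]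
    constructor
    · simp; ring
    · simp only [map_sub, map_mul, map_pow, map_one, map_ofNat, map_add, C_0]; ring

theorem askeyWilsonOp_eq (q : ℝ) :
    askeyWilsonOp q = divDiff (awAlpha q) 0 (awAlpha q ^ 2 - 1) := by
  refine (Polynomial.basisMonomials ℂ).ext fun n => ?_
  rw [askeyWilsonOp, Module.Basis.constr_basis, askeyWilsonMonomial_eq, coe_basisMonomials,
    X_pow_eq_monomial]

theorem affineConj_divDiff_latticeAvg (q : ℝ) {A : ℂ} (hA : A ≠ 0) (B : ℂ) (f : ℂ[X]) :
    A • affineConj A B (divDiff (awAlpha q) 0 (awAlpha q ^ 2 - 1)) f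
        = divDiff (awAlpha q) (awBeta q A B) (awGamma q A B) f ∧
      affineConj A B (latticeAvg (awAlpha q) 0 (awAlpha q ^ 2 - 1)) f
        = latticeAvg (awAlpha q) (awBeta q A B) (awGamma q A B) f := by
  induction f using polynomial_induction_X_mul with
  | hC c => simp [affineConj_apply]
  | hadd f g hf hg => simp only [map_add, smul_add, hf.1, hf.2, hg.1, hg.2, and_self]
  | hX f hf =>
    obtain ⟨h1, h2⟩ := hf
    rw [divDiff_X_mul, latticeAvg_X_mul, ← h1, ← h2]
    simp only [affineConj_apply, map_mul, affineSubst_X, add_mul, mul_assoc, map_add, divDiff_C_mul,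
      latticeAvg_C_mul, divDiff_X_mul, latticeAvg_X_mul, smul_eq_C_mul]
    simp only [latticeMean, latticeDisc_eq, map_mul, map_add, affineSubst_X, affineSubst_C, map_pow,
      awBeta, awGamma]
    generalize affineSubst A B (divDiff (awAlpha q) 0 (awAlpha q ^ 2 - 1)
      (affineSubst A⁻¹ (-(A⁻¹ * B)) f)) = F
    generalize affineSubst A B (latticeAvg (awAlpha q) 0 (awAlpha q ^ 2 - 1)
      (affineSubst A⁻¹ (-(A⁻¹ * B)) f)) = G
    constructor
    · refine Polynomial.funext fun t => ?_
      simp only [eval_add, eval_mul, eval_C, eval_X]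
      field_simp
      ring
    · refine Polynomial.funext fun t => ?_
      simp only [eval_add, eval_mul, eval_C, eval_X, eval_pow]
      field_simp
      ring

theorem rescaledAskeyWilsonOp_eq (q : ℝ) {A : ℂ} (hA : A ≠ 0) (B : ℂ) (f : ℂ[X]) :
    rescaledAskeyWilsonOp q A B f
      = divDiff (awAlpha q) (awBeta q A B) (awGamma q A B) f := by
  rw [← (affineConj_divDiff_latticeAvg q hA B f).1, affineConj_apply, affineSubst_apply,
    affineSubst_apply, rescaledAskeyWilsonOp, askeyWilsonOp_eq]
  congr 6
  rw [C_neg, C_mul]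
  ring

theorem awAlpha_sq {q : ℝ} (hq : 0 < q) : 2 * awAlpha q ^ 2 - 1 = ((q : ℂ) + (q : ℂ)⁻¹) / 2 := by
  have hr : ((√q : ℝ) : ℂ) ^ 2 = (q : ℂ) := by exact_mod_cast Real.sq_sqrt hq.le
  have hr0 : ((√q : ℝ) : ℂ) ≠ 0 := by exact_mod_cast (Real.sqrt_pos.mpr hq).ne'
  rw [awAlpha, ← hr]
  field_simp
  ring

theorem latticeMean₂_aw {q : ℝ} (hq : 0 < q) {A : ℂ} (hA : A ≠ 0) (B : ℂ) :
    latticeMean₂ (awAlpha q) (awBeta q A B)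
      = C A⁻¹ * (affineSubst A B (C (((q : ℂ) + (q : ℂ)⁻¹) / 2) * X) - C B) := by
  rw [← awAlpha_sq hq, latticeMean₂, awBeta]
  refine Polynomial.funext fun t => ?_
  simp only [map_mul, affineSubst_X, affineSubst_C, eval_add, eval_mul, eval_sub, eval_C, eval_X]
  field_simp
  ring

theorem latticeNorm₂_aw {q : ℝ} (hq : 0 < q) {A : ℂ} (hA : A ≠ 0) (B : ℂ) :
    latticeNorm₂ (awAlpha q) (awBeta q A B) (awGamma q A B)
      = C (A⁻¹ ^ 2) * (affineSubst A B (X ^ 2 + C ((((q : ℂ) + (q : ℂ)⁻¹) / 2) ^ 2 - 1))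
        - C (2 * B) * affineSubst A B (C (((q : ℂ) + (q : ℂ)⁻¹) / 2) * X) + C (B ^ 2)) := by
  rw [← awAlpha_sq hq, latticeNorm₂, latticeMean₂, latticeDisc_eq, awBeta, awGamma]
  refine Polynomial.funext fun t => ?_
  simp only [map_mul, affineSubst_X, affineSubst_C, eval_add, eval_mul, eval_sub, eval_C, eval_X,
    map_add, eval_pow, map_pow]
  field_simp
  ring

/-! ### Approximation by Askey-Wilson operators -/

/-- Vieta's formulas, with the roots of a quartic split off one at a time. -/
theorem exists_elementary_symmetric (e₁ e₂ e₃ e₄ : ℂ) : ∃ a b c d : ℂ, a + b + c + d = e₁ ∧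
    a * b + a * c + a * d + b * c + b * d + c * d = e₂ ∧
    a * b * c + a * b * d + a * c * d + b * c * d = e₃ ∧ a * b * c * d = e₄ := by
  have hroot (n : ℕ) (r : ℂ[X]) (hr : r.degree < (n + 1 : ℕ)) :
      ∃ x : ℂ, x ^ (n + 1) + r.eval x = 0 := by
    have hd : (X ^ (n + 1) + r).degree = ((n + 1 : ℕ) : WithBot ℕ) := by
      rw [degree_add_eq_left_of_degree_lt (by rwa [degree_X_pow]), degree_X_pow]
    obtain ⟨x, hx⟩ := IsAlgClosed.exists_root (X ^ (n + 1) + r)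
      (by rw [hd]; exact_mod_cast Nat.succ_ne_zero n)
    exact ⟨x, by simpa [IsRoot] using hx⟩
  have hdeg (n : ℕ) (r : ℂ[X]) (hr : r.natDegree ≤ n) : r.degree < (n + 1 : ℕ) :=
    degree_le_natDegree.trans_lt (by exact_mod_cast Nat.lt_succ_of_le hr)
  obtain ⟨a, ha⟩ := hroot 3 (C (-e₁) * X ^ 3 + C e₂ * X ^ 2 + C (-e₃) * X + C e₄)
    (hdeg _ _ natDegree_cubic_le)
  obtain ⟨s₁, hs₁⟩ : ∃ s, s = e₁ - a := ⟨_, rfl⟩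
  obtain ⟨s₂, hs₂⟩ : ∃ s, s = e₂ - a * s₁ := ⟨_, rfl⟩
  obtain ⟨s₃, hs₃⟩ : ∃ s, s = e₃ - a * s₂ := ⟨_, rfl⟩
  obtain ⟨b, hb⟩ := hroot 2 (C (-s₁) * X ^ 2 + C s₂ * X + C (-s₃))
    (hdeg _ _ natDegree_quadratic_le)
  obtain ⟨c, hc⟩ := hroot 1 (C (-(s₁ - b)) * X + C (s₂ - b * (s₁ - b)))
    (hdeg _ _ natDegree_linear_le)
  simp only [eval_add, eval_mul, eval_C, eval_X, eval_pow] at ha hb hc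
  subst hs₁ hs₂ hs₃
  refine ⟨a, b, c, e₁ - a - b - c, by ring, by linear_combination -hc,
    by linear_combination (-a - b) * hc + hb, ?_⟩
  linear_combination (-a * b) * hc + a * hb - ha

/-- The polynomials `ψ` and `π` are attained, exactly and approximately, by Askey-Wilson operators
up to a constant factor. -/
theorem exists_askeyWilsonPsi_askeyWilsonPi {q : ℂ} (hq : q ≠ 0) (hq1 : q ≠ 1) (hq2 : q ≠ -1)
    {π ψ : ℂ[X]} (hπ : π.natDegree ≤ 2) (hψ : ψ.natDegree ≤ 1) :
    ∃ e₀ e₁ e₂ e₃ e₄ : ℂ, askeyWilsonPsi q e₀ e₁ e₃ e₄ = ψ ∧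
      askeyWilsonPi q e₀ e₁ e₂ e₃ e₄ = π := by
  obtain ⟨y₁, y₀, rfl⟩ : ∃ y₁ y₀ : ℂ, ψ = C y₁ * X + C y₀ :=
    exists_eq_X_add_C_of_natDegree_le_one hψ
  obtain ⟨p₂, p₁, p₀, rfl⟩ : ∃ p₂ p₁ p₀ : ℂ, π = C p₂ * X ^ 2 + C p₁ * X + C p₀ :=
    ⟨_, _, _, eq_quadratic_of_degree_le_two (natDegree_le_iff_degree_le.mp hπ)⟩
  have hs : q⁻¹ - 1 ≠ 0 := sub_ne_zero.mpr (by rwa [ne_eq, inv_eq_one])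
  have hK : (q⁻¹ - 1) * (1 - q) * (1 + q⁻¹) / 4 ≠ 0 := by
    refine div_ne_zero (mul_ne_zero (mul_ne_zero hs (sub_ne_zero.mpr hq1.symm)) ?_) (by norm_num)
    intro h
    field_simp at h
    exact hq2 (by linear_combination h)
  simp only [askeyWilsonPi, askeyWilsonPsi]
  generalize (q⁻¹ - 1) * (1 - q) * (1 + q⁻¹) / 4 = K at hK
  generalize (1 - q) * (q⁻¹ - 1) / 2 = w
  generalize q⁻¹ - 1 = s at hs
  -- The polynomial `ψ` fixes `e₀ - e₄` and `e₁ - e₃`; then `π` fixes `e₀ + e₄`, `e₁ + e₃` and `e₂`.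
  refine ⟨((p₂ + w * y₁) / (2 * K) + y₁ / s) / 2, (-(p₁ + w * y₀) / K - 2 * y₀ / s) / 2,
    p₀ / K + (p₂ + w * y₁) / (2 * K), (-(p₁ + w * y₀) / K + 2 * y₀ / s) / 2,
    ((p₂ + w * y₁) / (2 * K) - y₁ / s) / 2, ?_, ?_⟩
  · refine Polynomial.funext fun t => ?_
    simp only [eval_add, eval_mul, eval_sub, eval_C, eval_X]
    field_simp
    ring
  · refine Polynomial.funext fun t => ?_
    simp only [eval_add, eval_mul, eval_sub, eval_C, eval_X, eval_pow]
    field_simp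
    ring

theorem C_mul_askeyWilsonPsi (q s e₀ e₁ e₃ e₄ : ℂ) : C s * askeyWilsonPsi q e₀ e₁ e₃ e₄
    = askeyWilsonPsi q (s * e₀) (s * e₁) (s * e₃) (s * e₄) := by
  refine Polynomial.funext fun t => ?_
  simp only [askeyWilsonPsi, eval_mul, eval_sub, eval_C, eval_X]
  ring

theorem C_mul_askeyWilsonPi (q s e₀ e₁ e₂ e₃ e₄ : ℂ) : C s * askeyWilsonPi q e₀ e₁ e₂ e₃ e₄
    = askeyWilsonPi q (s * e₀) (s * e₁) (s * e₂) (s * e₃) (s * e₄) := by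
  refine Polynomial.funext fun t => ?_
  simp only [askeyWilsonPi, askeyWilsonPsi, eval_mul, eval_sub, eval_add, eval_pow, eval_C, eval_X]
  ring

theorem askeyWilsonPsi_add (q e₀ e₁ e₃ e₄ δ : ℂ) :
    askeyWilsonPsi q (e₀ + δ) e₁ e₃ (e₄ + δ) = askeyWilsonPsi q e₀ e₁ e₃ e₄ := by
  simp [askeyWilsonPsi]

theorem askeyWilsonPi_add (q e₀ e₁ e₂ e₃ e₄ δ : ℂ) :
    askeyWilsonPi q (e₀ + δ) e₁ e₂ e₃ (e₄ + δ)
      = askeyWilsonPi q e₀ e₁ e₂ e₃ e₄ + C δ * askeyWilsonPi q 1 0 0 0 1 := by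
  refine Polynomial.funext fun t => ?_
  simp only [askeyWilsonPi, askeyWilsonPsi, eval_mul, eval_sub, eval_add, eval_pow, eval_C, eval_X]
  ring

theorem natDegree_askeyWilsonPsi_le (q e₀ e₁ e₃ e₄ : ℂ) :
    (askeyWilsonPsi q e₀ e₁ e₃ e₄).natDegree ≤ 1 := by
  rw [askeyWilsonPsi, sub_eq_add_neg, ← C_neg]
  exact natDegree_linear_le

theorem natDegree_askeyWilsonPi_le (q e₀ e₁ e₂ e₃ e₄ : ℂ) :
    (askeyWilsonPi q e₀ e₁ e₂ e₃ e₄).natDegree ≤ 2 := by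
  refine (natDegree_sub_le_of_le (m := 2) (n := 2) ?_ ?_).trans (by simp)
  · refine (natDegree_C_mul_le _ _).trans ?_
    rw [sub_eq_add_neg, ← neg_mul, ← C_neg]
    exact natDegree_quadratic_le
  · exact natDegree_mul_le_of_le (m := 1) (n := 1) ((natDegree_C_mul_le _ _).trans natDegree_X_le)
      (natDegree_askeyWilsonPsi_le _ _ _ _ _)

theorem exists_small_shift (e₀ e₄ : ℂ) (f : ℂ[X]) {ε : ℝ} (hε : 0 < ε) :
    ∃ δ : ℂ, e₀ + δ ≠ 0 ∧ e₄ + δ ≠ 0 ∧ ∀ i, ‖(C δ * f).coeff i‖ < ε := by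
  have hne (e : ℂ) : ∀ᶠ δ in 𝓝[≠] (0 : ℂ), e + δ ≠ 0 := by
    by_cases he : e = 0
    · filter_upwards [self_mem_nhdsWithin] with δ hδ
      simpa [he] using hδ
    · have : Tendsto (fun δ : ℂ => e + δ) (𝓝 0) (𝓝 (e + 0)) :=
        (continuous_const.add continuous_id).tendsto 0
      exact (this.eventually_ne (by simpa using he)).filter_mono nhdsWithin_le_nhds
  have hsmall : ∀ᶠ δ in 𝓝[≠] (0 : ℂ), ∀ i ∈ Finset.range (f.natDegree + 1),
      ‖(C δ * f).coeff i‖ < ε := by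
    rw [Finset.eventually_all]
    intro i _
    have : Tendsto (fun δ : ℂ => ‖(C δ * f).coeff i‖) (𝓝 0) (𝓝 ‖(0 : ℂ) * f.coeff i‖) := by
      simp only [coeff_C_mul]
      exact ((continuous_id.mul continuous_const).norm).tendsto 0
    rw [zero_mul, norm_zero] at this
    exact (this.eventually_lt_const hε).filter_mono nhdsWithin_le_nhds
  obtain ⟨δ, h1, h2, h3⟩ := ((hne e₀).and ((hne e₄).and hsmall)).exists
  refine ⟨δ, h1, h2, fun i => ?_⟩
  by_cases hi : i ∈ Finset.range (f.natDegree + 1)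
  · exact h3 i hi
  · rw [coeff_C_mul, coeff_eq_zero_of_natDegree_lt (by simpa using hi), mul_zero, norm_zero]
    exact hε

/-- Actual parameters need `e₀ ≠ 0`, to normalize it to `1`, and `e₄ ≠ 0`, to ensure `a ≠ 0`. Adding
the same small `δ` to both leaves `ψ` unchanged and moves `π` by a small multiple of a fixed
polynomial. -/
theorem exists_askeyWilson_near {q : ℝ} (hq0 : 0 < q) (hq1 : q < 1) {A : ℂ} (hA : A ≠ 0) (B : ℂ)
    {π ψ : ℂ[X]} (hπ : π.natDegree ≤ 2) (hψ : ψ.natDegree ≤ 1) {ε : ℝ} (hε : 0 < ε) :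
    ∃ (a b c d : ℂ) (π' : ℂ[X]) (T : ℂ[X] →ₗ[ℂ] ℂ[X]), a ≠ 0 ∧
      π'.natDegree ≤ 2 ∧ (∀ i, ‖π'.coeff i - π.coeff i‖ < ε) ∧
      SatisfiesRecursion T (latticeMean₂ (awAlpha q) (awBeta q A B))
        (latticeNorm₂ (awAlpha q) (awBeta q A B) (awGamma q A B)) π' ψ ∧
      ∀ n, (affineSubst A B (askeyWilsonPoly q a b c d n)).natDegree ≤ n ∧
        T (affineSubst A B (askeyWilsonPoly q a b c d n))
          = C ((T (X ^ n)).coeff n) * affineSubst A B (askeyWilsonPoly q a b c d n) ∧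
        ((∀ i < n, (T (X ^ i)).coeff i ≠ (T (X ^ n)).coeff n) →
          (affineSubst A B (askeyWilsonPoly q a b c d n)).coeff n ≠ 0) := by
  have hq : (q : ℂ) ≠ 0 := by exact_mod_cast hq0.ne'
  have hqpow (j : ℕ) : (q : ℂ) ^ (j + 1) ≠ 1 := by
    exact_mod_cast (pow_lt_one₀ hq0.le hq1 (Nat.succ_ne_zero j)).ne
  have hqne : (q : ℂ) ≠ -1 := by
    have h : q ≠ -1 := by linarith
    exact_mod_cast h
  set τ := affineSubst A⁻¹ (-(A⁻¹ * B)) with hτ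
  obtain ⟨e₀, e₁, e₂, e₃, e₄, hψe, hπe⟩ := exists_askeyWilsonPsi_askeyWilsonPi hq
    (by simpa using hqpow 0) hqne
    (π := C (A ^ 2) * τ π) (ψ := C A * τ ψ)
    ((natDegree_C_mul_le _ _).trans ((natDegree_affineSubst_le _ _ _).trans hπ))
    ((natDegree_C_mul_le _ _).trans ((natDegree_affineSubst_le _ _ _).trans hψ))
  obtain ⟨δ, hs, hs₄, hδ⟩ := exists_small_shift e₀ e₄
    (C (A⁻¹ ^ 2) * affineSubst A B (askeyWilsonPi q 1 0 0 0 1)) hε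
  set s := e₀ + δ with hsdef
  obtain ⟨a, b, c, d, h₁, h₂, h₃, h₄⟩ := exists_elementary_symmetric
    (e₁ / s) (e₂ / s) (e₃ / s) ((e₄ + δ) / s)
  have ha : a ≠ 0 := by
    rintro rfl
    simp only [zero_mul] at h₄
    exact div_ne_zero hs₄ hs h₄.symm
  set T₀ := askeyWilsonSecondOrder hq ha b c d with hT₀
  set T := affineConj A B (s • T₀) with hT
  have hrec := ((askeyWilsonSecondOrder_recursion b c d hq ha).smul s).affineConj hA B
  rw [← latticeMean₂_aw hq0 hA, ← latticeNorm₂_aw hq0 hA, C_mul_askeyWilsonPi,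
    C_mul_askeyWilsonPsi, h₁, h₂, h₃, h₄, mul_one, mul_div_cancel₀ _ hs, mul_div_cancel₀ _ hs,
    mul_div_cancel₀ _ hs, mul_div_cancel₀ _ hs, hsdef, askeyWilsonPsi_add, askeyWilsonPi_add, hψe,
    hπe, ← hsdef, ← hT₀, ← hT] at hrec
  simp only [map_mul, map_add, affineSubst_C, hτ, affineSubst_inv_apply hA] at hrec
  have hψ' : C A⁻¹ * (C A * ψ) = ψ := by
    rw [← mul_assoc, ← C_mul, inv_mul_cancel₀ hA, C_1, one_mul]
  have hπ' : C (A⁻¹ ^ 2) * (C (A ^ 2) * π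
        + C δ * affineSubst A B (askeyWilsonPi q 1 0 0 0 1))
      = π + C δ * (C (A⁻¹ ^ 2) * affineSubst A B (askeyWilsonPi q 1 0 0 0 1)) := by
    rw [mul_add, ← mul_assoc, ← C_mul, ← mul_pow, inv_mul_cancel₀ hA, one_pow, C_1, one_mul]
    ring
  rw [hψ', hπ'] at hrec
  have hπ'deg : (π + C δ * (C (A⁻¹ ^ 2)
      * affineSubst A B (askeyWilsonPi q 1 0 0 0 1))).natDegree ≤ 2 :=
    natDegree_add_le_of_degree_le hπ ((natDegree_C_mul_le _ _).trans ((natDegree_C_mul_le _ _).trans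
      ((natDegree_affineSubst_le _ _ _).trans (natDegree_askeyWilsonPi_le _ _ _ _ _ _))))
  have htri := hrec.natDegree_le (natDegree_latticeMean₂_le _ _) (natDegree_latticeNorm₂_le _ _ _)
    hπ'deg hψ
  have hdiag (n : ℕ) :
      (T (X ^ n)).coeff n = s * askeyWilsonEigenvalue q (a * b * c * d) n := by
    have hg := degree_affineSubst hA B (askeyWilsonBasis q a n)
    rw [degree_askeyWilsonBasis hq ha] at hg
    have hc := coeff_map_top htri (natDegree_eq_of_degree_eq_some hg).le
    rw [hT, affineConj_affineSubst hA, LinearMap.smul_apply, askeyWilsonSecondOrder_basis,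
      smul_eq_C_mul, mul_add, map_add, coeff_add] at hc
    have hz : (affineSubst A B (C s * (C (askeyWilsonSubdiagonal q a b c d n)
        * askeyWilsonBasis q a (n - 1)))).coeff n = 0 := by
      cases n with
      | zero => simp [askeyWilsonSubdiagonal]
      | succ n =>
        apply coeff_eq_zero_of_natDegree_lt
        refine (natDegree_affineSubst_le _ _ _).trans_lt ((natDegree_C_mul_le _ _).trans_lt
          ((natDegree_C_mul_le _ _).trans_lt ?_))
        rw [natDegree_askeyWilsonBasis hq ha]
        omega
    rw [hz, add_zero, map_mul, map_mul, affineSubst_C, affineSubst_C, coeff_C_mul, coeff_C_mul,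
      ← mul_assoc, mul_comm] at hc
    exact (mul_left_cancel₀ (coeff_ne_zero_of_eq_degree hg) hc).symm
  refine ⟨a, b, c, d, _, T, ha, hπ'deg, fun i => ?_, hrec, fun n => ⟨?_, ?_, fun hn => ?_⟩⟩
  · rw [coeff_add, add_sub_cancel_left]
    exact hδ i
  · exact (natDegree_affineSubst_le _ _ _).trans (natDegree_askeyWilsonPoly_le hq ha b c d n)
  · rw [hdiag, hT, affineConj_affineSubst hA, LinearMap.smul_apply, hT₀,
      askeyWilsonSecondOrder_askeyWilsonPoly hq hqpow, smul_eq_C_mul, map_mul, map_mul,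
      affineSubst_C, affineSubst_C, C_mul]
    ring
  · refine coeff_ne_zero_of_eq_degree ?_
    rw [degree_affineSubst hA]
    refine degree_askeyWilsonPoly hq hqpow ha fun i hi h => hn i hi ?_
    rw [hdiag, hdiag, h]

/-! ### Limits of Askey-Wilson polynomials -/

theorem isLimitingAskeyWilson_of_latticeOp {q : ℕ → ℝ} {A B : ℕ → ℂ}
    (hq : ∀ j, 0 < q j ∧ q j < 1) (hA : ∀ j, A j ≠ 0) {α β γ : ℂ}
    (hα : Tendsto (fun j => awAlpha (q j)) atTop (𝓝 α))
    (hβ : Tendsto (fun j => awBeta (q j) (A j) (B j)) atTop (𝓝 β))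
    (hγ : Tendsto (fun j => awGamma (q j) (A j) (B j)) atTop (𝓝 γ)) {φ ψ : ℂ[X]}
    (hφ : φ.natDegree ≤ 2) (hψ : ψ.natDegree ≤ 1) {y : ℕ → ℂ[X]} (hy : ∀ n, (y n).degree = n)
    {ev : ℕ → ℂ} (hev : Function.Injective ev)
    (h : ∀ n, latticeOp α β γ φ ψ (y n) = C (ev n) * y n) : IsLimitingAskeyWilson q A B y := by
  set T₀ := latticeOp α β γ φ ψ with hT₀def
  have hT₀ : SatisfiesRecursion T₀ (latticeMean₂ α β) (latticeNorm₂ α β γ)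
      (C (2 * α) * φ + (X - latticeMean₂ α β) * ψ) ψ :=
    ⟨by simp [hT₀def, latticeOp_apply], by simp [hT₀def, latticeOp_apply],
      latticeOp_X_mul_X_mul α β γ φ ψ⟩
  have hπ := natDegree_latticeOp_inhomogeneity_le α β hφ hψ
  choose a b c d π T ha hπdeg hπnear hT hP using fun j =>
    exists_askeyWilson_near (hq j).1 (hq j).2 (hA j) (B j) hπ hψ (Nat.one_div_pos_of_nat (n := j))
  have hyn (n : ℕ) := natDegree_eq_of_degree_eq_some (hy n)
  have hlim_l : TendstoPoly (fun j => latticeMean₂ (awAlpha (q j)) (awBeta (q j) (A j) (B j)))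
      (latticeMean₂ α β) :=
    ((TendstoPoly.C (((hα.pow 2).const_mul 2).sub_const 1)).mul (.const X)).add
      (.C ((hβ.const_mul 2).mul (hα.add_const 1)))
  have hlim_U : TendstoPoly (fun j => latticeDisc (awAlpha (q j)) (awBeta (q j) (A j) (B j))
      (awGamma (q j) (A j) (B j))) (latticeDisc α β γ) := by
    simp only [latticeDisc_eq]
    exact (((TendstoPoly.C ((hα.pow 2).sub_const 1)).mul (.const (X ^ 2))).add
      ((TendstoPoly.C (((hα.const_mul 2).mul hβ).add (hβ.const_mul 2))).mul (.const X))).add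
      (.C ((hβ.pow 2).sub hγ))
  have hlim_κ : TendstoPoly (fun j => latticeNorm₂ (awAlpha (q j)) (awBeta (q j) (A j) (B j))
      (awGamma (q j) (A j) (B j))) (latticeNorm₂ α β γ) := by
    simp only [latticeNorm₂, pow_two (latticeMean₂ _ _)]
    exact (hlim_l.mul hlim_l).sub ((TendstoPoly.C ((hα.pow 2).const_mul 4)).mul hlim_U)
  have hlim_π : TendstoPoly π (C (2 * α) * φ + (X - latticeMean₂ α β) * ψ) := fun i => by
    rw [tendsto_iff_norm_sub_tendsto_zero]
    exact squeeze_zero (fun _ => norm_nonneg _) (fun j => (hπnear j i).le)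
      tendsto_one_div_add_atTop_nhds_zero_nat
  have hconv := SatisfiesRecursion.tendsto hT hT₀ hlim_l hlim_κ hlim_π (.const ψ)
  have htri₀ := hT₀.natDegree_le (natDegree_latticeMean₂_le _ _) (natDegree_latticeNorm₂_le _ _ _)
    hπ hψ
  have htri (j : ℕ) := (hT j).natDegree_le (natDegree_latticeMean₂_le _ _)
    (natDegree_latticeNorm₂_le _ _ _) (hπdeg j) hψ
  have hdiag (n : ℕ) : (T₀ (X ^ n)).coeff n = ev n := by
    have hc := coeff_map_top htri₀ (hyn n).le
    rw [h, coeff_C_mul, mul_comm] at hc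
    exact (mul_left_cancel₀ (coeff_ne_zero_of_eq_degree (hy n)) hc).symm
  have hne (n i : ℕ) (hi : i < n) : (T₀ (X ^ i)).coeff i ≠ (T₀ (X ^ n)).coeff n := by
    rw [hdiag, hdiag]
    exact fun h => hi.ne (hev h)
  let P : ℕ → ℕ → ℂ[X] := fun n j =>
    affineSubst (A j) (B j) (askeyWilsonPoly (q j) (a j) (b j) (c j) (d j) n)
  -- The multiplier matches leading coefficients. For finitely many `j` the denominator may vanish
  -- and the quotient is `0`; eventually the diagonal entries are distinct and the degree is exact.
  refine ⟨hy, a, b, c, d, ha, fun n j => (y n).coeff n / (P n j).coeff n, fun n => ?_⟩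
  refine tendstoPoly_of_eigen htri htri₀ hconv (hne n) (fun j => ?_) (hyn n).le ?_ (fun j => ?_)
    (by rw [hdiag, h])
  · exact (natDegree_smul_le _ _).trans (hP j n).1
  · have hev' : ∀ᶠ j in atTop, ∀ i ∈ Finset.range n,
        (T j (X ^ i)).coeff i ≠ (T j (X ^ n)).coeff n := by
      rw [Finset.eventually_all]
      intro i hi
      filter_upwards [((hconv i i).sub (hconv n n)).eventually_ne
        (sub_ne_zero.mpr (hne n i (Finset.mem_range.mp hi)))] with j hj
      exact sub_ne_zero.mp hj
    filter_upwards [hev'] with j hj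
    rw [coeff_smul, smul_eq_mul]
    exact div_mul_cancel₀ _ ((hP j n).2.2 fun i hi => hj i (Finset.mem_range.mpr hi))
  · rw [map_smul, mul_smul_comm]
    congr 1
    exact (hP j n).2.1

theorem exists_real_lead {x : ℝ} (hx : 1 ≤ x) (n : ℕ) : ∃ g h : ℝ, 0 ≤ g ∧ 1 ≤ h ∧
    diffLead (x : ℂ) n = g ∧ avgLead (x : ℂ) n = h := by
  induction n with
  | zero => exact ⟨0, 1, le_rfl, le_rfl, by simp [diffLead], by simp [avgLead]⟩
  | succ n ih =>
    obtain ⟨g, h, hg, hh, e1, e2⟩ := ih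
    refine ⟨h + x * g, (x ^ 2 - 1) * g + x * h, by positivity, ?_, ?_, ?_⟩
    · have h1 : 0 ≤ (x ^ 2 - 1) * g := mul_nonneg (by nlinarith) hg
      nlinarith
    · rw [diffLead, e1, e2]; push_cast; ring
    · rw [avgLead, e1, e2]; push_cast; ring

theorem diffLead_ne_zero {x : ℝ} (hx : 1 ≤ x) (n : ℕ) : diffLead (x : ℂ) (n + 1) ≠ 0 := by
  obtain ⟨g, h, hg, hh, e1, e2⟩ := exists_real_lead hx n
  rw [diffLead, e1, e2]
  have : h + x * g ≠ 0 := by positivity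
  exact_mod_cast this

theorem exists_one_le_awAlpha {q : ℝ} (hq : 0 < q) : ∃ x : ℝ, 1 ≤ x ∧ awAlpha q = x := by
  have hr := Real.sqrt_pos.mpr hq
  refine ⟨(√q + (√q)⁻¹) / 2, ?_, by rw [awAlpha]; push_cast; rfl⟩
  have h : √q * (√q)⁻¹ = 1 := mul_inv_cancel₀ hr.ne'
  nlinarith [sq_nonneg (√q - (√q)⁻¹), inv_pos.mpr hr]

/-- The limits of rescaled Askey-Wilson operators are divided difference operators of lattices. -/
theorem exists_lattice_of_tendsto {q : ℕ → ℝ} {A B : ℕ → ℂ} (hq : ∀ j, 0 < q j ∧ q j < 1)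
    (hA : ∀ j, A j ≠ 0) {L : ℂ[X] →ₗ[ℂ] ℂ[X]}
    (hL : ∀ f, TendstoPoly (fun j => rescaledAskeyWilsonOp (q j) (A j) (B j) f) (L f)) :
    ∃ α β γ : ℂ, Tendsto (fun j => awAlpha (q j)) atTop (𝓝 α) ∧
      Tendsto (fun j => awBeta (q j) (A j) (B j)) atTop (𝓝 β) ∧
      Tendsto (fun j => awGamma (q j) (A j) (B j)) atTop (𝓝 γ) ∧
      (∀ n, diffLead α (n + 1) ≠ 0) ∧ L = divDiff α β γ := by
  simp only [fun j f => rescaledAskeyWilsonOp_eq (q j) (hA j) (B j) f] at hL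
  have hsq (α β γ : ℂ) : divDiff α β γ (X ^ 2) = C (2 * α) * X + C (2 * β) := by
    have := divDiff_quadratic α β γ 1 0 0
    simpa using this
  have hcube (α β γ : ℂ) : divDiff α β γ (X ^ 3)
      = C (4 * α ^ 2 - 1) * X ^ 2 + C (8 * α * β + 2 * β) * X + C (4 * β ^ 2 - γ) := by
    rw [pow_succ', divDiff_X_mul, hsq]
    have := latticeAvg_quadratic α β γ 1 0 0
    simp only [C_1, C_0, one_mul, zero_mul, add_zero] at this
    rw [this, latticeMean]
    simp only [map_mul, map_ofNat, map_sub, map_add, map_pow, map_one]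
    ring
  -- Convergence on `X ^ 2` and `X ^ 3` alone already yields the limits of the three lattice
  -- parameters.
  obtain ⟨α, hα⟩ : ∃ α, Tendsto (fun j => awAlpha (q j)) atTop (𝓝 α) := by
    refine ⟨(L (X ^ 2)).coeff 1 / 2, ((hL (X ^ 2) 1).div_const 2).congr fun j => ?_⟩
    simp [hsq]
  obtain ⟨β, hβ⟩ : ∃ β, Tendsto (fun j => awBeta (q j) (A j) (B j)) atTop (𝓝 β) := by
    refine ⟨(L (X ^ 2)).coeff 0 / 2, ((hL (X ^ 2) 0).div_const 2).congr fun j => ?_⟩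
    simp [hsq]
  obtain ⟨γ, hγ⟩ : ∃ γ, Tendsto (fun j => awGamma (q j) (A j) (B j)) atTop (𝓝 γ) := by
    refine ⟨4 * β ^ 2 - (L (X ^ 3)).coeff 0,
      (((hβ.pow 2).const_mul 4).sub (hL (X ^ 3) 0)).congr fun j => ?_⟩
    simp only [hcube, coeff_add, coeff_C_mul, coeff_X_pow, coeff_X_zero, coeff_C_zero]
    simp
  refine ⟨α, β, γ, hα, hβ, hγ, ?_, ?_⟩
  -- Each `awAlpha (q j)` is real and at least `1`, by the arithmetic-geometric mean inequality. The
  -- limit inherits this, which keeps all `diffLead α (n + 1)` nonzero.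
  · have hre : ∃ x : ℝ, 1 ≤ x ∧ α = x := by
      choose x hx1 hx using fun j => exists_one_le_awAlpha (hq j).1
      simp only [hx] at hα
      have h1 : Tendsto x atTop (𝓝 α.re) :=
        (Complex.continuous_re.tendsto α).comp hα
      have h2 : Tendsto (fun j => ((x j : ℝ) : ℂ)) atTop (𝓝 (α.re : ℂ)) :=
        (Complex.continuous_ofReal.tendsto _).comp h1
      exact ⟨α.re, ge_of_tendsto' h1 hx1, tendsto_nhds_unique hα h2⟩
    obtain ⟨x, hx, rfl⟩ := hre
    exact diffLead_ne_zero hx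
  · have hlim_e : TendstoPoly (fun j => latticeMean (awAlpha (q j)) (awBeta (q j) (A j) (B j)))
        (latticeMean α β) := ((TendstoPoly.C hα).mul (.const X)).add (.C hβ)
    have hlim_U : TendstoPoly (fun j => latticeDisc (awAlpha (q j)) (awBeta (q j) (A j) (B j))
        (awGamma (q j) (A j) (B j))) (latticeDisc α β γ) := by
      simp only [latticeDisc_eq]
      exact (((TendstoPoly.C ((hα.pow 2).sub_const 1)).mul (.const (X ^ 2))).add
        ((TendstoPoly.C (((hα.const_mul 2).mul hβ).add (hβ.const_mul 2))).mul (.const X))).add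
        (.C ((hβ.pow 2).sub hγ))
    have hmon (n : ℕ) : TendstoPoly (fun j => divDiff (awAlpha (q j)) (awBeta (q j) (A j) (B j))
          (awGamma (q j) (A j) (B j)) (X ^ n)) (divDiff α β γ (X ^ n)) ∧
        TendstoPoly (fun j => latticeAvg (awAlpha (q j)) (awBeta (q j) (A j) (B j))
          (awGamma (q j) (A j) (B j)) (X ^ n)) (latticeAvg α β γ (X ^ n)) := by
      induction n with
      | zero => simp only [pow_zero, divDiff_one, latticeAvg_one]; exact ⟨.const 0, .const 1⟩
      | succ n ih =>
        simp only [pow_succ' (X : ℂ[X]) n, divDiff_X_mul, latticeAvg_X_mul]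
        exact ⟨(hlim_e.mul ih.1).add ih.2, (hlim_e.mul ih.2).add (hlim_U.mul ih.1)⟩
    refine (Polynomial.basisMonomials ℂ).ext fun n => ?_
    change L (monomial n 1) = divDiff α β γ (monomial n 1)
    rw [← X_pow_eq_monomial]
    exact (hL (X ^ n)).unique (hmon n).1

theorem isOrthogonalSequence_iff {p : ℕ → ℂ[X]} :
    IsOrthogonalSequence p ↔ ∃ u, OrthogonalWith p u :=
  ⟨fun ⟨h, u, h1, h2⟩ => ⟨u, h, h1, h2⟩, fun ⟨u, h⟩ => ⟨h.1, u, h.2, h.3⟩⟩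

theorem isLimitingAskeyWilson_of_tendsto {q : ℕ → ℝ} {A B : ℕ → ℂ} (hq : ∀ j, 0 < q j ∧ q j < 1)
    (hA : ∀ j, A j ≠ 0) {L : ℂ[X] →ₗ[ℂ] ℂ[X]}
    (hL : ∀ f, TendstoPoly (fun j => rescaledAskeyWilsonOp (q j) (A j) (B j) f) (L f))
    {k : ℕ} (hk : 1 ≤ k) {p : ℕ → ℂ[X]} (hp : IsOrthogonalSequence p)
    (hQ : IsOrthogonalSequence (fun n => (L ^ k) (p (n + k)))) (m : ℕ) :
    IsLimitingAskeyWilson q A B (fun n => (L ^ m) (p (n + m))) := by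
  obtain ⟨α, β, γ, hα, hβ, hγ, hne, rfl⟩ := exists_lattice_of_tendsto hq hA hL
  obtain ⟨u, hu⟩ := isOrthogonalSequence_iff.mp hp
  obtain ⟨v, hv⟩ := isOrthogonalSequence_iff.mp hQ
  obtain ⟨k, rfl⟩ : ∃ k', k = k' + 1 := ⟨k - 1, by omega⟩
  obtain ⟨φ, ψ, hφ, hψ, ev, hev, h⟩ := exists_latticeOp_eigen_divDiff_pow hne hu k hv m
  exact isLimitingAskeyWilson_of_latticeOp hq hA hα hβ hγ hφ hψ
    (fun n => degree_divDiff_pow hne m (hu.degree_eq _)) hev h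

/-! ### Affine forms of the limiting operators -/

theorem IsOrthogonalSequence.affineSubst {p : ℕ → ℂ[X]} (hp : IsOrthogonalSequence p) {a : ℂ}
    (ha : a ≠ 0) (b : ℂ) : IsOrthogonalSequence (fun n => affineSubst a b (p n)) := by
  obtain ⟨hd, u, h1, h2⟩ := hp
  refine ⟨fun n => by rw [degree_affineSubst ha, hd],
    u.comp (_root_.affineSubst a⁻¹ (-(a⁻¹ * b))).toLinearMap, fun m n hmn => ?_, fun n => ?_⟩
  · rw [← map_mul, LinearMap.comp_apply, AlgHom.toLinearMap_apply, affineSubst_apply_inv ha]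
    exact h1 m n hmn
  · rw [← map_mul, LinearMap.comp_apply, AlgHom.toLinearMap_apply, affineSubst_apply_inv ha]
    exact h2 n

theorem IsOrthogonalSequence.smul {p : ℕ → ℂ[X]} (hp : IsOrthogonalSequence p) {c : ℂ}
    (hc : c ≠ 0) : IsOrthogonalSequence (fun n => c • p n) := by
  obtain ⟨hd, u, h1, h2⟩ := hp
  refine ⟨fun n => (degree_smul_of_smul_regular _ (IsSMulRegular.of_ne_zero hc)).trans (hd n), u, fun m n hmn => ?_, fun n => ?_⟩
  · rw [smul_mul_smul_comm, map_smul, h1 m n hmn, smul_zero]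
  · rw [smul_mul_smul_comm, map_smul]
    exact smul_ne_zero (mul_ne_zero hc hc) (h2 n)

theorem IsLimitingAskeyWilson.smul {q : ℕ → ℝ} {A B : ℕ → ℂ} {y : ℕ → ℂ[X]}
    (hy : IsLimitingAskeyWilson q A B y) {s : ℂ} (hs : s ≠ 0) :
    IsLimitingAskeyWilson q A B (fun n => s • y n) := by
  obtain ⟨hd, a, b, c, d, ha, μ, h⟩ := hy
  refine ⟨fun n => (degree_smul_of_smul_regular _ (IsSMulRegular.of_ne_zero hs)).trans (hd n), a, b, c, d, ha,
    fun n j => s * μ n j, fun n i => ?_⟩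
  simp only [mul_smul, coeff_smul s, smul_eq_mul s]
  exact (h n i).const_mul s

/-- Powers of an operator `κ (L f)(a x + b)`, where `L` is equivariant under the substitution. -/
theorem affine_equivariant_pow {L D : ℂ[X] →ₗ[ℂ] ℂ[X]} {κ a b : ℂ} (hκ : κ ≠ 0) (ha : a ≠ 0)
    (hL : ∀ f, L (affineSubst a b f) = a • affineSubst a b (L f))
    (hD : ∀ f, D f = κ • affineSubst a b (L f)) (m : ℕ) :
    ∃ c a' b' s : ℂ, c ≠ 0 ∧ a' ≠ 0 ∧ s ≠ 0 ∧ (∀ f, (D ^ m) f = c • affineSubst a' b' ((L ^ m) f)) ∧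
      ∀ f, L (affineSubst a' b' f) = s • affineSubst a' b' (L f) := by
  induction m with
  | zero =>
    exact ⟨1, 1, 0, 1, one_ne_zero, one_ne_zero, one_ne_zero,
      fun f => by simp [affineSubst_one_zero], fun f => by simp [affineSubst_one_zero]⟩
  | succ m ih =>
    obtain ⟨c, a', b', s, hc, ha', hs, h1, h2⟩ := ih
    refine ⟨κ * c * s, a' * a, a' * b + b', s * a, mul_ne_zero (mul_ne_zero hκ hc) hs,
      mul_ne_zero ha' ha, mul_ne_zero hs ha, fun f => ?_, fun f => ?_⟩
    · rw [pow_succ', pow_succ', Module.End.mul_apply, Module.End.mul_apply, h1, hD, map_smul, h2,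
        ← affineSubst_affineSubst]
      simp only [map_smul, smul_smul]
      ring_nf
    · rw [← affineSubst_affineSubst, hL, h2, ← affineSubst_affineSubst]
      simp only [map_smul, smul_smul]
      ring_nf

-- The main theorem

theorem theorem2 (k : ℕ) (hk : 1 ≤ k) (p : ℕ → ℂ[X]) (hp : IsOrthogonalSequence p) :
    -- the Askey-Wilson operator itself: fixed base, no change of variable
    (∀ q : ℝ, 0 < q → q < 1 →
      IsOrthogonalSequence (fun n => (askeyWilsonOp q ^ k) (p (n + k))) →
      ∀ m : ℕ, IsLimitingAskeyWilson (fun _ => q) (fun _ => 1) (fun _ => 0)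
        (fun n => (askeyWilsonOp q ^ m) (p (n + m)))) ∧
    -- a limiting case of it
    (∀ (q : ℕ → ℝ) (A B : ℕ → ℂ) (D : ℂ[X] →ₗ[ℂ] ℂ[X]),
      (∀ j, 0 < q j ∧ q j < 1) → (∀ j, A j ≠ 0) →
      IsLimitingAskeyWilsonOp q A B D →
      IsOrthogonalSequence (fun n => (D ^ k) (p (n + k))) →
      ∀ m : ℕ, IsLimitingAskeyWilson q A B
        (fun n => (D ^ m) (p (n + m)))) := by
  refine ⟨fun q hq0 hq1 hQ m => ?_, fun q A B D hq hA hD hQ m => ?_⟩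
  · refine isLimitingAskeyWilson_of_tendsto (fun _ => ⟨hq0, hq1⟩) (fun _ => one_ne_zero)
      (fun f => ?_) hk hp hQ m
    have h (f : ℂ[X]) : rescaledAskeyWilsonOp q 1 0 f = askeyWilsonOp q f := by
      simp [rescaledAskeyWilsonOp]
    simp only [h]
    exact .const _
  · obtain ⟨L, κ, a, b, hκ, ha, hL, hequiv, hDL⟩ := hD
    simp only [← affineSubst_apply] at hequiv hDL
    obtain ⟨c, a', b', s, hc, ha', hs, hDm, hs'⟩ := affine_equivariant_pow hκ ha hequiv hDL m
    obtain ⟨c₁, a₁, b₁, s₁, hc₁, ha₁, -, hDk, -⟩ := affine_equivariant_pow hκ ha hequiv hDL k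
    have hpow (i : ℕ) (f : ℂ[X]) :
        (L ^ i) (affineSubst a' b' f) = s ^ i • affineSubst a' b' ((L ^ i) f) := by
      induction i with
      | zero => simp
      | succ i ih =>
        rw [pow_succ', Module.End.mul_apply, ih, map_smul, hs', smul_smul, ← pow_succ,
          Module.End.mul_apply]
    have hLk : IsOrthogonalSequence (fun n => (L ^ k) (p (n + k))) := by
      have h := (hQ.smul (inv_ne_zero hc₁)).affineSubst (inv_ne_zero ha₁) (-(a₁⁻¹ * b₁))
      simpa only [hDk, smul_smul, inv_mul_cancel₀ hc₁, one_smul, affineSubst_apply_inv ha₁] using h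
    -- Up to a constant, `D ^ m` applied to `p` is `L ^ m` applied to the substituted sequence. The
    -- substitution is thus moved onto `p`, so the limit is taken along the original `q`, `A`, `B`.
    have hQ' : IsOrthogonalSequence (fun n => (L ^ k) (affineSubst a' b' (p (n + k)))) := by
      simp only [hpow]
      exact (hLk.affineSubst ha' b').smul (pow_ne_zero k hs)
    have h := isLimitingAskeyWilson_of_tendsto hq hA hL hk (hp.affineSubst ha' b') hQ' m
    simp only [hpow] at h
    have h' := h.smul (mul_ne_zero hc (inv_ne_zero (pow_ne_zero m hs)))
    simpa only [hDm, smul_smul, mul_assoc, inv_mul_cancel₀ (pow_ne_zero m hs), mul_one] using h'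

end
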